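/- Let $K$ be a field, $d\ge 1$ an integer, and $\ell=(\ell_1,\dots,\ell_n)\in\mathbb{N}^n$ a finite sequence of nonnegative integers. For a monomial $u$ let $\max(u)$ be the largest $i$ such that $x_i$ divides $u$, and for a monomial ideal $I$ let $G(I)$ be its set of minimal monomial generators. The following three conditions are equivalent. (a) There is a nonzero ideal $I\subset K[x_1,\dots,x_n]$ that is strongly stable (a monomial ideal such that, for every monomial $u$ and all $p<q$, $ux_q\in I$ implies $ux_p\in I$) and generated in degree $d$, with $|\{u\in G(I):\max(u)=k\}|=\ell_k$ for $k=1,\dots,n$. (b) There is a nonzero ideal $I\subset K[x_1,\dots,x_{n+d-1}]$ that is squarefree strongly stable (generated by squarefree monomials, and such that for every squarefree monomial $u\in I$ and all $p<q$ with $x_p\nmid u$ and $x_q\mid u$ one has $u(x_p/x_q)\in I$) and generated in degree $d$, with $|\{u\in G(I):\max(u)=k+d-1\}|=\ell_k$ for $k=1,\dots,n$. (c) $\ell$ is an $M$-vector with $\ell_2\le d$ (the latter condition is void if $n<2$). Here $\ell$ is an $M$-vector if $n\ge 1$ and, with $h_t=\ell_{t+1}$, one has $h_0=1$ and $h_{t+1}\le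 h_t^{\langle t\rangle}$ for $1\le t\le n-2$, where $0^{\langle t\rangle}=0$ and, for $a>0$ with $t$-th Macaulay representation $a=\binom{a(t)}{t}+\binom{a(t-1)}{t-1}+\cdots+\binom{a(j)}{j}$, $a(t)>a(t-1)>\cdots>a(j)\ge j\ge 1$, one sets $a^{\langle t\rangle}=\binom{a(t)+1}{t+1}+\binom{a(t-1)+1}{t}+\cdots+\binom{a(j)+1}{j+1}$. -/

import Mathlib

namespace MonomialIdeals

open MvPolynomial

/- A monomial `x^u` in the variables `x_1, …, x_m` is represented by its exponent vector
`u : Fin m →₀ ℕ`; the variable `x_i` (for `1 ≤ i ≤ m`) has the index `i - 1 : Fin m`.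
Divisibility of monomials is the pointwise order on exponent vectors. -/

/-- The set of monomials that lie in the ideal `I`. -/
def monomialsIn {K : Type*} [Field K] {m : ℕ} (I : Ideal (MvPolynomial (Fin m) K)) :
    Set (Fin m →₀ ℕ) :=
  {u | monomial u (1 : K) ∈ I}

/-- `I` is a monomial ideal: it is generated by monomials. -/
def IsMonomialIdeal {K : Type*} [Field K] {m : ℕ} (I : Ideal (MvPolynomial (Fin m) K)) : Prop :=
  ∃ V : Set (Fin m →₀ ℕ), I = Ideal.span ((fun u => monomial u (1 : K)) '' V)

/-- The set `G(I)` of minimal monomial generators of a monomial ideal `I`: the monomials in `I`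
that are minimal with respect to divisibility. -/
def minGens {K : Type*} [Field K] {m : ℕ} (I : Ideal (MvPolynomial (Fin m) K)) :
    Set (Fin m →₀ ℕ) :=
  {u | Minimal (fun v => v ∈ monomialsIn I) u}

/-- `I` is generated in degree `d`: it is generated by homogeneous polynomials of degree `d`. -/
def IsGeneratedInDegree {K : Type*} [Field K] {m : ℕ} (I : Ideal (MvPolynomial (Fin m) K))
    (d : ℕ) : Prop :=
  ∃ F : Set (MvPolynomial (Fin m) K), (∀ f ∈ F, f.IsHomogeneous d) ∧ I = Ideal.span F

/-- A set `V` of monomials is strongly stable if `u x_q ∈ V` and `p < q` imply `u x_p ∈ V`. -/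
def IsStronglyStableSet {m : ℕ} (V : Set (Fin m →₀ ℕ)) : Prop :=
  ∀ (u : Fin m →₀ ℕ) (p q : Fin m), p < q →
    u + Finsupp.single q 1 ∈ V → u + Finsupp.single p 1 ∈ V

/-- A strongly stable ideal. -/
def IsStronglyStable {K : Type*} [Field K] {m : ℕ} (I : Ideal (MvPolynomial (Fin m) K)) : Prop :=
  IsMonomialIdeal I ∧ IsStronglyStableSet (monomialsIn I)

/-- The monomial `x^u` is squarefree. -/
def IsSquarefreeMonomial {m : ℕ} (u : Fin m →₀ ℕ) : Prop :=
  ∀ i, u i ≤ 1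

/-- `I` is a squarefree monomial ideal: it is generated by squarefree monomials. -/
def IsSquarefreeMonomialIdeal {K : Type*} [Field K] {m : ℕ}
    (I : Ideal (MvPolynomial (Fin m) K)) : Prop :=
  ∃ V : Set (Fin m →₀ ℕ), (∀ u ∈ V, IsSquarefreeMonomial u) ∧
    I = Ideal.span ((fun u => monomial u (1 : K)) '' V)

/-- A set `V` of squarefree monomials is squarefree strongly stable if `u (x_p / x_q) ∈ V` for all
`u ∈ V` and all `p < q` such that `x_p` does not divide `u` and `x_q` divides `u`. -/
def IsSquarefreeStronglyStableSet {m : ℕ} (V : Set (Fin m →₀ ℕ)) : Prop :=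
  ∀ u ∈ V, ∀ p q : Fin m, p < q → p ∉ u.support → q ∈ u.support →
    u - Finsupp.single q 1 + Finsupp.single p 1 ∈ V

/-- A squarefree strongly stable ideal: a squarefree monomial ideal whose set of squarefree
monomials is squarefree strongly stable. -/
def IsSquarefreeStronglyStable {K : Type*} [Field K] {m : ℕ}
    (I : Ideal (MvPolynomial (Fin m) K)) : Prop :=
  IsSquarefreeMonomialIdeal I ∧
    IsSquarefreeStronglyStableSet {u | u ∈ monomialsIn I ∧ IsSquarefreeMonomial u}

/-- `max(u)`: the largest `i ∈ {1, …, m}` such that `x_i` divides the monomial `u`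
(and `0` for `u = 1`). -/
def maxVar {m : ℕ} (u : Fin m →₀ ℕ) : ℕ :=
  u.support.sup (fun i => (i : ℕ) + 1)

/-- The `ℓ`-sequence `(ℓ_1(I), …, ℓ_n(I))`, where `ℓ_k(I)` is the number of `u ∈ G(I)` with
`max(u) = k`; the entry `ℓ_k(I)` has the index `k - 1 : Fin n`. -/
noncomputable def ellSeq {K : Type*} [Field K] {n : ℕ} (I : Ideal (MvPolynomial (Fin n) K)) :
    Fin n → ℕ :=
  fun k => {u | u ∈ minGens I ∧ maxVar u = (k : ℕ) + 1}.ncard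

/-- The `ℓ*`-sequence `(ℓ*_1(I), …, ℓ*_n(I))` of an ideal `I` in `n + d - 1` variables, where
`ℓ*_k(I)` is the number of `u ∈ G(I)` with `max(u) = k + d - 1`; the entry `ℓ*_k(I)` has the
index `k - 1 : Fin n`. -/
noncomputable def ellStarSeq {K : Type*} [Field K] (n d : ℕ)
    (I : Ideal (MvPolynomial (Fin (n + d - 1)) K)) : Fin n → ℕ :=
  fun k => {u | u ∈ minGens I ∧ maxVar u = ((k : ℕ) + 1) + d - 1}.ncard

/-- `a = C(c t, t) + C(c (t-1), t-1) + ⋯ + C(c j, j)` with `c t > c (t-1) > ⋯ > c j ≥ j ≥ 1` is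
the `t`-th Macaulay representation of `a`. -/
def IsMacaulayRep (t a j : ℕ) (c : ℕ → ℕ) : Prop :=
  1 ≤ j ∧ j ≤ t ∧ j ≤ c j ∧ StrictMonoOn c (Set.Icc j t) ∧
    a = ∑ i ∈ Finset.Icc j t, (c i).choose i

/-- `b = a^⟨t⟩`: if `a > 0` has the `t`-th Macaulay representation
`a = C(c t, t) + ⋯ + C(c j, j)`, then `a^⟨t⟩ = C(c t + 1, t + 1) + ⋯ + C(c j + 1, j + 1)`;
moreover `0^⟨t⟩ = 0`. -/
def IsMacaulayUpper (t a b : ℕ) : Prop :=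
  (a = 0 ∧ b = 0) ∨
    ∃ (j : ℕ) (c : ℕ → ℕ), IsMacaulayRep t a j c ∧
      b = ∑ i ∈ Finset.Icc j t, (c i + 1).choose (i + 1)

/-- `h = (h_0, h_1, …, h_{n-1})`, `n ≥ 1`, is an `M`-vector: `h_0 = 1` and
`h_{t+1} ≤ (h_t)^⟨t⟩` for all `t ≥ 1` (with `t + 1 ≤ n - 1`). -/
def IsMVector {n : ℕ} (h : Fin n → ℕ) : Prop :=
  (∃ hn : 0 < n, h ⟨0, hn⟩ = 1) ∧
    ∀ (t : ℕ) (_ : 1 ≤ t) (ht : t + 1 < n),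
      ∃ b, IsMacaulayUpper t (h ⟨t, (Nat.lt_succ_self t).trans ht⟩) b ∧ h ⟨t + 1, ht⟩ ≤ b

end MonomialIdeals

/-! A monomial of degree `d + 1` is a weakly increasing sequence of variable indices. Adding `i` to
the `i`-th index turns it into a squarefree monomial in `d` more variables. In both settings the
exchange condition on the generators says exactly that the set of index sequences is closed downward
among weakly increasing sequences, and `max` is read off from the last entry. Hence (a) and (b) are
both equivalent to the existence of an `IsStableFamily` with prescribed numbers of members by last
entry.

Conjugation of partitions links this to Macaulay's theorem. A sequence with last entry `t` is
conjugate to one of length `t` with entries from `1` to `d + 1`. After subtracting 1, the members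
with last entry `t` become a down-closed set `A t` of sequences of length `t` with entries at most
`d`, and `Fin.tail` maps `A (t + 1)` into `A t`. So `A 0` is a single point and `A 1` has at most `d
+ 1` elements. A weakly increasing `c` also encodes a Macaulay representation, with tops `c i + i`
over `i + 1` and vanishing terms where `c i = 0`. Its value is `digitSum 1 c`, and its upper power
is `digitSum 1 c + digitSum 2 c`.

The growth condition is `macaulay_bound`, which rests on a Green-type restriction bound,
`hyperplane_bound`, proved by induction on the length. Conversely, for an M-vector let `A t` consist
of the first `ℓ_{t+1}` sequences in colexicographic order; `digitSum_tail_le` makes these segments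
compatible with tails. -/

namespace MonomialIdeals

/-! ### Colexicographic ranks and Pascal identities. -/

/-- For `k = 1` this is the rank of the weakly increasing sequence `c` in the colexicographic order;
the numbers `c i + i` are the digits of this rank in the combinatorial number system. -/
def digitSum (k : ℕ) {t : ℕ} (c : Fin t → ℕ) : ℕ :=
  ∑ i : Fin t, (c i + i).choose (i + k)

theorem digitSum_succ (k : ℕ) {t : ℕ} (c : Fin (t + 1) → ℕ) :
    digitSum k c = digitSum k (Fin.init c) + (c (Fin.last t) + t).choose (t + k) := by
  simp [digitSum, Fin.sum_univ_castSucc, Fin.init]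

theorem digitSum_mono (k : ℕ) {t : ℕ} {c c' : Fin t → ℕ} (h : c ≤ c') :
    digitSum k c ≤ digitSum k c' :=
  Finset.sum_le_sum fun i _ => Nat.choose_le_choose _ (Nat.add_le_add_right (h i) _)

/-- Hockey stick identity: with all entries equal to `N` the sum is `C(N + t, t) - 1`. The strict
inequality is what makes the last entry the leading digit of the rank. -/
theorem digitSum_one_lt {t : ℕ} (N : ℕ) (c : Fin t → ℕ) (h : ∀ i, c i ≤ N) :
    digitSum 1 c < (N + t).choose t := by
  induction t with
  | zero => simp [digitSum]
  | succ t ih =>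
    rw [digitSum_succ]
    have h1 := ih (Fin.init c) fun i => h _
    have h2 : (c (Fin.last t) + t).choose (t + 1) ≤ (N + t).choose (t + 1) :=
      Nat.choose_le_choose _ (Nat.add_le_add_right (h _) _)
    rw [← add_assoc, Nat.choose_succ_succ]
    exact add_lt_add_of_lt_of_le h1 h2

theorem digitSum_two_le {t : ℕ} (N : ℕ) (c : Fin t → ℕ) (h : ∀ i, c i ≤ N) :
    digitSum 2 c ≤ (N + t).choose (t + 1) := by
  induction t with
  | zero => simp [digitSum]
  | succ t ih =>
    rw [digitSum_succ]
    have h1 := ih (Fin.init c) fun i => h _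
    have h2 : (c (Fin.last t) + t).choose (t + 2) ≤ (N + t).choose (t + 2) :=
      Nat.choose_le_choose _ (Nat.add_le_add_right (h _) _)
    rw [← add_assoc, Nat.choose_succ_succ]
    exact add_le_add h1 h2

theorem monotone_init {t : ℕ} {c : Fin (t + 1) → ℕ} (hc : Monotone c) : Monotone (Fin.init c) :=
  fun _ _ h => hc (Fin.castSucc_le_castSucc_iff.2 h)

theorem monotone_tail {t : ℕ} {c : Fin (t + 1) → ℕ} (hc : Monotone c) : Monotone (Fin.tail c) :=
  fun _ _ h => hc (Fin.succ_le_succ_iff.2 h)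

theorem monotone_snoc {t : ℕ} {c : Fin t → ℕ} (hc : Monotone c) {m : ℕ} (h : ∀ i, c i ≤ m) :
    Monotone (Fin.snoc c m : Fin (t + 1) → ℕ) := by
  intro i j hij
  induction j using Fin.lastCases with
  | last =>
    induction i using Fin.lastCases with
    | last => exact le_rfl
    | cast i => simpa using h i
  | cast j =>
    induction i using Fin.lastCases with
    | last => exact absurd hij (not_le.2 (Fin.castSucc_lt_last j))
    | cast i => simpa using hc (Fin.castSucc_le_castSucc_iff.1 hij)

theorem monotone_cons_zero {t : ℕ} {c : Fin t → ℕ} (hc : Monotone c) :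
    Monotone (Fin.cons 0 c : Fin (t + 1) → ℕ) := by
  intro i j hij
  induction i using Fin.cases with
  | zero => simp
  | succ i =>
    induction j using Fin.cases with
    | zero => exact absurd hij (not_le.2 (Fin.succ_pos i))
    | succ j => simpa using hc (Fin.succ_le_succ_iff.1 hij)

theorem digitSum_one_lt_of_last_lt {t : ℕ} {c c' : Fin (t + 1) → ℕ} (hc : Monotone c)
    (h : c (Fin.last t) < c' (Fin.last t)) : digitSum 1 c < digitSum 1 c' := by
  have h1 := digitSum_one_lt _ c fun i => hc (Fin.le_last i)
  have h2 : (c (Fin.last t) + (t + 1)).choose (t + 1) ≤ (c' (Fin.last t) + t).choose (t + 1) :=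
    Nat.choose_le_choose _ (by omega)
  rw [digitSum_succ 1 c']
  omega

/-- The numbers `digitSum 2` depend monotonically on the colexicographic rank. -/
theorem digitSum_two_le_of_one_le {t : ℕ} {c c' : Fin t → ℕ} (hc : Monotone c)
    (hc' : Monotone c') (h : digitSum 1 c ≤ digitSum 1 c') : digitSum 2 c ≤ digitSum 2 c' := by
  induction t with
  | zero => simp [digitSum]
  | succ t ih =>
    rcases lt_trichotomy (c (Fin.last t)) (c' (Fin.last t)) with hlt | heq | hgt
    · have h1 := digitSum_two_le _ c fun i => hc (Fin.le_last i)
      have h2 : (c (Fin.last t) + (t + 1)).choose (t + 2) ≤ (c' (Fin.last t) + t).choose (t + 2) :=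
        Nat.choose_le_choose _ (by omega)
      rw [digitSum_succ 2 c']
      exact h1.trans (h2.trans (Nat.le_add_left _ _))
    · rw [digitSum_succ, digitSum_succ, heq] at h ⊢
      exact Nat.add_le_add_right
        (ih (monotone_init hc) (monotone_init hc') (Nat.le_of_add_le_add_right h)) _
    · exact absurd h (not_le.2 (digitSum_one_lt_of_last_lt hc' hgt))

theorem digitSum_one_injOn {t : ℕ} {c c' : Fin t → ℕ} (hc : Monotone c) (hc' : Monotone c')
    (h : digitSum 1 c = digitSum 1 c') : c = c' := by
  induction t with
  | zero => exact Subsingleton.elim _ _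
  | succ t ih =>
    have heq : c (Fin.last t) = c' (Fin.last t) := by
      rcases lt_trichotomy (c (Fin.last t)) (c' (Fin.last t)) with hlt | heq | hgt
      · exact absurd h (digitSum_one_lt_of_last_lt hc hlt).ne
      · exact heq
      · exact absurd h (digitSum_one_lt_of_last_lt hc' hgt).ne'
    rw [digitSum_succ, digitSum_succ, heq] at h
    rw [← Fin.snoc_init_self c, ← Fin.snoc_init_self c', heq,
      ih (monotone_init hc) (monotone_init hc') (Nat.add_right_cancel h)]

/-- Greedy expansion: the last entry is the largest `m` with `C(m + t, t + 1) ≤ a`. The remainder is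
then below `C(m + t, t)`, so its expansion has entries at most `m` and monotonicity is preserved.
The induction on `N` searches for `m`. -/
theorem exists_digitSum_one_eq_of_lt (t N a : ℕ) (h : a < (N + t).choose t) :
    ∃ c : Fin t → ℕ, Monotone c ∧ (∀ i, c i ≤ N) ∧ digitSum 1 c = a := by
  induction t generalizing N a with
  | zero => exact ⟨0, monotone_const, fun _ => Nat.zero_le _, by simp_all [digitSum]⟩
  | succ t ih =>
    have key : ∀ m, (m + t).choose (t + 1) ≤ a → a < (m + (t + 1)).choose (t + 1) →
        ∃ c : Fin (t + 1) → ℕ, Monotone c ∧ (∀ i, c i ≤ m) ∧ digitSum 1 c = a := by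
      intro m h1 h2
      rw [← add_assoc, Nat.choose_succ_succ] at h2
      obtain ⟨c, hc, hcm, hca⟩ := ih m (a - (m + t).choose (t + 1)) (by simp at h2; omega)
      refine ⟨Fin.snoc c m, monotone_snoc hc hcm, fun i => ?_, ?_⟩
      · induction i using Fin.lastCases with
        | last => simp
        | cast i => simpa using hcm i
      · rw [digitSum_succ, Fin.init_snoc, Fin.snoc_last, hca]
        omega
    induction N with
    | zero => exact key 0 (by simp) h
    | succ N ihN =>
      by_cases h' : a < (N + (t + 1)).choose (t + 1)
      · obtain ⟨c, hc, hcN, hca⟩ := ihN h'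
        exact ⟨c, hc, fun i => (hcN i).trans (Nat.le_succ N), hca⟩
      · refine key (N + 1) ?_ h
        rw [show N + 1 + t = N + (t + 1) by omega]
        omega

theorem exists_digitSum_one_eq (t a : ℕ) :
    ∃ c : Fin (t + 1) → ℕ, Monotone c ∧ digitSum 1 c = a := by
  obtain ⟨c, hc, -, hca⟩ := exists_digitSum_one_eq_of_lt (t + 1) a a (by
    calc a < a + 1 := Nat.lt_succ_self a
      _ = (a + 1).choose a := by simp
      _ ≤ (a + (t + 1)).choose a := Nat.choose_le_choose _ (by omega)
      _ = (a + (t + 1)).choose (t + 1) := Nat.choose_symm_add)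
  exact ⟨c, hc, hca⟩

/-- Pascal's rule: `digitSum 1 c + digitSum 2 c` is the rank of `c` raised to `⟨t⟩`. -/
theorem digitSum_one_add_two {t : ℕ} (c : Fin t → ℕ) :
    digitSum 1 c + digitSum 2 c = ∑ i : Fin t, (c i + i + 1).choose (i + 2) := by
  rw [digitSum, digitSum, ← Finset.sum_add_distrib]
  exact Finset.sum_congr rfl fun i _ => (Nat.choose_succ_succ _ _).symm

/-- Pascal's rule raises the tops lowered by 1 back to `c i + i`; where `c i = 0` both sides vanish.
This is the recursion behind `sum_le_of_hyperplane`. -/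
theorem digitSum_add_pred {t : ℕ} (c : Fin t → ℕ) :
    digitSum 1 (fun i => c i - 1) + digitSum 2 (fun i => c i - 1) = digitSum 2 c := by
  rw [digitSum_one_add_two]
  refine Finset.sum_congr rfl fun i _ => ?_
  rcases Nat.eq_zero_or_pos (c i) with h | h
  · simp [h, Nat.choose_eq_zero_of_lt]
  · rw [show c i - 1 + i + 1 = c i + i by omega]

/-- Pascal's rule is exact in all positions but the first. There `c 0` is compared with `c 0 - 1`,
which accounts for the final 1. -/
theorem digitSum_one_le_tail {t : ℕ} (c : Fin (t + 1) → ℕ) :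
    digitSum 1 c ≤ digitSum 1 (fun i => c i - 1) + digitSum 1 (Fin.tail c) + 1 := by
  have h : ∀ i : Fin t, (c i.succ + (i + 1)).choose (i + 1 + 1) =
      (c i.succ - 1 + (i + 1)).choose (i + 1 + 1) + (c i.succ + i).choose (i + 1) := by
    intro i
    rcases Nat.eq_zero_or_pos (c i.succ) with h | h
    · simp [h]
    · rw [show c i.succ - 1 + (i + 1) = c i.succ + i by omega, ← add_assoc,
        Nat.choose_succ_succ, add_comm]
  simp only [digitSum, Fin.sum_univ_succ, Fin.val_succ, h, Finset.sum_add_distrib, Fin.tail]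
  simp
  omega

/-- The terms agree after the index shift; the right side only has the additional term `c 0 - 1`. -/
theorem digitSum_two_tail_le {t : ℕ} (c : Fin (t + 1) → ℕ) :
    digitSum 2 (Fin.tail c) ≤ digitSum 1 (fun i => c i - 1) := by
  simp only [digitSum, Fin.sum_univ_succ (n := t), Fin.val_succ, Fin.tail]
  refine le_add_left (Finset.sum_le_sum fun i _ => ?_)
  rcases Nat.eq_zero_or_pos (c i.succ) with h | h
  · simp [h, Nat.choose_eq_zero_of_lt]
  · rw [show c i.succ - 1 + (i + 1) = c i.succ + i by omega]

/-! ### Green's and Macaulay's bounds for stable sets. -/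

/-- A finite set of weakly increasing sequences that is closed under passing to
smaller weakly increasing sequences. -/
def IsStableFinset {t : ℕ} (A : Finset (Fin t → ℕ)) : Prop :=
  ∀ v ∈ A, Monotone v ∧ ∀ w, Monotone w → w ≤ v → w ∈ A

/-- `B` is obtained by subtracting 1 from every entry of the members with positive first entry; each
such member loses exactly 1 from its first entry. -/
theorem IsStableFinset.exists_shift {t : ℕ} {A : Finset (Fin (t + 1) → ℕ)}
    (hA : IsStableFinset A) : ∃ B : Finset (Fin (t + 1) → ℕ), IsStableFinset B ∧
      B.card = (A.filter fun v => 1 ≤ v 0).card ∧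
      ∑ v ∈ A, v 0 = B.card + ∑ v ∈ B, v 0 := by
  classical
  have hpos : ∀ v ∈ A, 1 ≤ v 0 → ∀ i, 1 ≤ v i := fun v hv h i =>
    h.trans ((hA v hv).1 (Fin.zero_le i))
  have hinj : Set.InjOn (fun (v : Fin (t + 1) → ℕ) i => v i - 1)
      (A.filter fun v => 1 ≤ v 0 : Finset (Fin (t + 1) → ℕ)) := by
    intro v hv w hw h
    simp only [Finset.coe_filter, Set.mem_ofPred_eq] at hv hw
    ext i
    have h1 := congrFun h i
    have h2 := hpos v hv.1 hv.2 i
    have h3 := hpos w hw.1 hw.2 i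
    simp only at h1
    omega
  refine ⟨(A.filter fun v => 1 ≤ v 0).image fun v i => v i - 1, ?_,
    Finset.card_image_of_injOn hinj, ?_⟩
  · intro v hv
    obtain ⟨u, hu, rfl⟩ := Finset.mem_image.1 hv
    obtain ⟨hu, hu0⟩ := Finset.mem_filter.1 hu
    refine ⟨fun i j h => Nat.sub_le_sub_right ((hA u hu).1 h) 1, fun w hw hwu => ?_⟩
    refine Finset.mem_image.2 ⟨fun i => w i + 1, Finset.mem_filter.2 ⟨?_, by simp⟩, by simp⟩
    refine (hA u hu).2 _ (fun i j h => Nat.add_le_add_right (hw h) 1) fun i => ?_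
    have h1 := hwu i
    have h2 := hpos u hu hu0 i
    simp only at h1 ⊢
    omega
  · rw [Finset.card_image_of_injOn hinj, Finset.sum_image hinj, Finset.card_eq_sum_ones,
      ← Finset.sum_add_distrib, Finset.sum_filter]
    refine Finset.sum_congr rfl fun v _ => ?_
    split_ifs with h
    · exact (Nat.add_sub_cancel' h).symm
    · omega

/-- Fibre over the tail: a first entry before `w` must lie between `k` and `w 0`. -/
theorem card_le_sum_of_tail_mem {t : ℕ} (k : ℕ) {A : Finset (Fin (t + 1) → ℕ)}
    {B : Finset (Fin (t + 2) → ℕ)} (hB : ∀ v ∈ B, Monotone v ∧ k ≤ v 0 ∧ Fin.tail v ∈ A) :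
    B.card ≤ ∑ w ∈ A, (w 0 + 1 - k) := by
  classical
  have h : B ⊆ (A.sigma fun w => Finset.Icc k (w 0)).image
      fun x : (Σ _ : Fin (t + 1) → ℕ, ℕ) => (Fin.cons x.2 x.1 : Fin (t + 2) → ℕ) := by
    intro v hv
    obtain ⟨h1, h2, h3⟩ := hB v hv
    exact Finset.mem_image.2 ⟨⟨Fin.tail v, v 0⟩, Finset.mem_sigma.2
      ⟨h3, Finset.mem_Icc.2 ⟨h2, h1 (Fin.zero_le _)⟩⟩, Fin.cons_self_tail v⟩
  refine (Finset.card_le_card h).trans (Finset.card_image_le.trans ?_)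
  simp [Finset.card_sigma]

/-- If every stable set satisfies the hyperplane restriction bound, then it satisfies the
bound for the sum of the minimal entries. -/
theorem sum_le_of_hyperplane {t : ℕ}
    (H : ∀ (A : Finset (Fin (t + 1) → ℕ)) (c : Fin (t + 1) → ℕ), IsStableFinset A → Monotone c →
      A.card = digitSum 1 c → (A.filter fun v => 1 ≤ v 0).card ≤ digitSum 1 fun i => c i - 1)
    (A : Finset (Fin (t + 1) → ℕ)) (c : Fin (t + 1) → ℕ) (hA : IsStableFinset A)
    (hc : Monotone c) (h : A.card = digitSum 1 c) : ∑ v ∈ A, v 0 ≤ digitSum 2 c := by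
  induction hn : A.card using Nat.strong_induction_on generalizing A c with
  | _ n ih =>
    subst hn
    rcases A.eq_empty_or_nonempty with rfl | ⟨v, hv⟩
    · simp
    -- `B` is strictly smaller than `A` because the zero sequence is lost. By `H` its rank is at
    -- most that of `c - 1`, and `digitSum_add_pred` closes the recursion.
    obtain ⟨B, hB, hBA, hsum⟩ := hA.exists_shift
    have h0 : (0 : Fin (t + 1) → ℕ) ∈ A :=
      (hA v hv).2 0 monotone_const fun i => Nat.zero_le _
    have hlt : B.card < A.card := by
      rw [hBA]
      refine Finset.card_lt_card (Finset.filter_ssubset.2 ⟨0, h0, by simp⟩)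
    obtain ⟨c', hc', hcard⟩ := exists_digitSum_one_eq t B.card
    have h1 : digitSum 1 c' ≤ digitSum 1 (fun i => c i - 1) := by
      rw [hcard, hBA]
      exact H A c hA hc h
    have h2 := digitSum_two_le_of_one_le hc'
      (show Monotone fun i => c i - 1 from fun i j hij => Nat.sub_le_sub_right (hc hij) 1) h1
    have h3 := ih _ hlt B c' hB hc' hcard.symm rfl
    have h4 := digitSum_add_pred c
    omega

/-- The hyperplane restriction bound (Green) for stable sets. -/
theorem hyperplane_bound (t : ℕ) (A : Finset (Fin (t + 1) → ℕ)) (c : Fin (t + 1) → ℕ)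
    (hA : IsStableFinset A) (hc : Monotone c) (h : A.card = digitSum 1 c) :
    (A.filter fun v => 1 ≤ v 0).card ≤ digitSum 1 fun i => c i - 1 := by
  classical
  induction t with
  | zero =>
    have h1 : digitSum 1 c = c 0 := by simp [digitSum]
    have h2 : digitSum 1 (fun i => c i - 1) = c 0 - 1 := by simp [digitSum]
    rcases A.eq_empty_or_nonempty with rfl | ⟨v, hv⟩
    · simp
    have h0 : (0 : Fin 1 → ℕ) ∈ A := (hA v hv).2 0 monotone_const fun i => Nat.zero_le _
    have : (A.filter fun v => 1 ≤ v 0).card < A.card :=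
      Finset.card_lt_card (Finset.filter_ssubset.2 ⟨0, h0, by simp⟩)
    omega
  | succ t ih =>
    set A' := A.filter fun v => 1 ≤ v 0 with hA'
    set A₀ := A.filter fun v => ¬ 1 ≤ v 0 with hA₀
    have hsplit : A'.card + A₀.card = A.card := Finset.card_filter_add_card_filter_not _
    set B := A₀.image Fin.tail with hBdef
    have hmemB : ∀ w, w ∈ B ↔ (Fin.cons 0 w : Fin (t + 2) → ℕ) ∈ A := by
      intro w
      constructor
      · intro hw
        obtain ⟨v, hv, rfl⟩ := Finset.mem_image.1 hw
        obtain ⟨hv, hv0⟩ := Finset.mem_filter.1 hv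
        rw [show 0 = v 0 by omega, Fin.cons_self_tail]
        exact hv
      · intro hw
        exact Finset.mem_image.2 ⟨_, Finset.mem_filter.2 ⟨hw, by simp⟩, Fin.tail_cons _ _⟩
    have hBcard : B.card = A₀.card := by
      refine Finset.card_image_of_injOn fun v hv w hw hvw => ?_
      have h1 := (Finset.mem_filter.1 hv).2
      have h2 := (Finset.mem_filter.1 hw).2
      rw [← Fin.cons_self_tail v, ← Fin.cons_self_tail w, hvw, show v 0 = w 0 by omega]
    have hB : IsStableFinset B := by
      intro v hv
      have hv' := hA _ ((hmemB v).1 hv)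
      refine ⟨by simpa using monotone_tail hv'.1, fun w hw hwv => (hmemB w).2 ?_⟩
      exact hv'.2 _ (monotone_cons_zero hw) (Fin.cons_le_cons.2 ⟨le_rfl, hwv⟩)
    -- Lowering the first entry to 0 stays inside `A`. Hence `A'.card` is at most the sum of the
    -- first entries over `B`, which the induction hypothesis controls.
    have htail : ∀ v ∈ A', Monotone v ∧ 1 ≤ v 0 ∧ Fin.tail v ∈ B := by
      intro v hv
      obtain ⟨hv, hv0⟩ := Finset.mem_filter.1 hv
      refine ⟨(hA v hv).1, hv0, (hmemB _).2 ((hA v hv).2 _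
        (monotone_cons_zero (monotone_tail (hA v hv).1)) ?_)⟩
      conv_rhs => rw [← Fin.cons_self_tail v]
      exact Fin.cons_le_cons.2 ⟨Nat.zero_le _, le_rfl⟩
    have h1 := card_le_sum_of_tail_mem 1 htail
    simp only [Nat.add_sub_cancel] at h1
    obtain ⟨b, hb, hbB⟩ := exists_digitSum_one_eq t B.card
    have h2 := sum_le_of_hyperplane ih B b hB hb hbB.symm
    -- If the bound failed, `B.card = A.card - A'.card` would be at most the rank of `Fin.tail c`.
    -- Then `A'.card ≤ digitSum 2 b ≤ digitSum 2 (Fin.tail c)`, which is again at most the bound.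
    by_contra hcon
    have h3 := digitSum_one_le_tail c
    have h4 := digitSum_two_le_of_one_le hb (monotone_tail hc) (by omega)
    have h5 := digitSum_two_tail_le c
    omega

/-- Macaulay's bound for stable sets. -/
theorem macaulay_bound {t : ℕ} {A : Finset (Fin (t + 1) → ℕ)} {B : Finset (Fin (t + 2) → ℕ)}
    (hA : IsStableFinset A) (hB : ∀ v ∈ B, Monotone v ∧ Fin.tail v ∈ A) {c : Fin (t + 1) → ℕ}
    (hc : Monotone c) (h : A.card = digitSum 1 c) : B.card ≤ digitSum 1 c + digitSum 2 c := by
  have h1 := card_le_sum_of_tail_mem 0 (A := A) (B := B)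
    fun v hv => ⟨(hB v hv).1, Nat.zero_le _, (hB v hv).2⟩
  have h2 := sum_le_of_hyperplane (hyperplane_bound t) A c hA hc h
  simp only [Nat.sub_zero, Finset.sum_add_distrib, Finset.sum_const, smul_eq_mul, mul_one] at h1
  omega

/-- The inequality converse to `macaulay_bound`, for a single sequence. -/
theorem digitSum_tail_le {t : ℕ} (c : Fin (t + 1) → ℕ) :
    digitSum 1 (Fin.tail c) + digitSum 2 (Fin.tail c) ≤ digitSum 1 c := by
  rw [digitSum_one_add_two, digitSum, Fin.sum_univ_succ]
  exact Nat.le_add_left _ _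

/-! ### Macaulay representations as weakly increasing sequences. -/

theorem isMacaulayUpper_digitSum {t : ℕ} {c : Fin t → ℕ} (hc : Monotone c) :
    IsMacaulayUpper t (digitSum 1 c) (digitSum 1 c + digitSum 2 c) := by
  by_cases h0 : ∀ i, c i = 0
  · left
    simp [digitSum, h0, Nat.choose_eq_zero_of_lt]
  push Not at h0
  right
  have hex : ∃ k, ∃ hk : k < t, c ⟨k, hk⟩ ≠ 0 := by
    obtain ⟨i, hi⟩ := h0
    exact ⟨i, i.2, hi⟩
  classical
  -- The representation starts at `j = k + 1`, where `k` is the first position with a nonzero entry;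
  -- earlier positions contribute zero binomials.
  set k := Nat.find hex with hkdef
  obtain ⟨hkt, hk⟩ := Nat.find_spec hex
  have hz : ∀ i : Fin t, (i : ℕ) < k → c i = 0 := by
    intro i hi
    have := Nat.find_min hex hi
    push Not at this
    exact this i.2
  set e : ℕ → ℕ := fun i => if h : i - 1 < t then c ⟨i - 1, h⟩ + (i - 1) else 0 with he
  have hsum : ∀ f : ℕ → ℕ → ℕ, (∀ i < k, f i i = 0) →
      ∑ i : Fin t, f i (c i + i) = ∑ i ∈ Finset.Icc (k + 1) t, f (i - 1) (e i) := by
    intro f hf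
    have h1 : ∑ i : Fin t, f i (c i + i) = ∑ i ∈ Finset.range t, f i (e (i + 1)) := by
      rw [Finset.sum_range]
      refine Finset.sum_congr rfl fun i _ => ?_
      simp [he]
    rw [h1, Finset.range_eq_Ico, ← Finset.sum_Ico_consecutive _ (Nat.zero_le k) hkt.le,
      Finset.sum_eq_zero, zero_add]
    · rw [← Finset.Ico_add_one_right_eq_Icc, ← Finset.sum_Ico_add' (fun i => f (i - 1) (e i)) k t 1]
      simp
    · intro i hi
      have hik := (Finset.mem_Ico.1 hi).2
      have : e (i + 1) = i := by
        simp only [he, Nat.add_sub_cancel]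
        rw [dif_pos (hik.trans hkt), hz ⟨i, hik.trans hkt⟩ hik, zero_add]
      rw [this, hf i hik]
  refine ⟨k + 1, e, ⟨Nat.le_add_left _ _, hkt, ?_, ?_, ?_⟩, ?_⟩
  · have : e (k + 1) = c ⟨k, hkt⟩ + k := by
      simp only [he, Nat.add_sub_cancel]
      exact dif_pos hkt
    rw [this]
    have : 0 < c ⟨k, hkt⟩ := Nat.pos_of_ne_zero hk
    omega
  · intro i hi j hj hij
    have hi' : i - 1 < t := by have := hi.1; have := hi.2; omega
    have hj' : j - 1 < t := by have := hj.1; have := hj.2; omega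
    simp only [he, dif_pos hi', dif_pos hj']
    have hle : c ⟨i - 1, hi'⟩ ≤ c ⟨j - 1, hj'⟩ := hc (by simp; omega)
    have := hi.1
    omega
  · rw [digitSum, hsum (fun i x => x.choose (i + 1)) (by simp)]
    refine Finset.sum_congr rfl fun i hi => ?_
    rw [Nat.sub_add_cancel (by have := (Finset.mem_Icc.1 hi).1; omega)]
  · rw [digitSum_one_add_two, hsum (fun i x => (x + 1).choose (i + 2)) (by simp)]
    refine Finset.sum_congr rfl fun i hi => ?_
    rw [show i - 1 + 2 = i + 1 by have := (Finset.mem_Icc.1 hi).1; omega]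

theorem IsMacaulayUpper.exists_digitSum {t a b : ℕ} (h : IsMacaulayUpper t a b) :
    ∃ c : Fin t → ℕ, Monotone c ∧ digitSum 1 c = a ∧ digitSum 1 c + digitSum 2 c = b := by
  rcases h with ⟨rfl, rfl⟩ | ⟨j, e, ⟨hj, hjt, hje, hmono, rfl⟩, rfl⟩
  · exact ⟨0, monotone_const, by simp [digitSum],
      by simp [digitSum, Nat.choose_eq_zero_of_lt]⟩
  have hge : ∀ i, j ≤ i → i ≤ t → i ≤ e i := by
    intro i hji
    induction i, hji using Nat.le_induction with
    | base => exact fun _ => hje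
    | succ i hji ih =>
      intro hit
      have h1 := ih (by omega)
      have h2 := hmono ⟨hji, by omega⟩ ⟨by omega, hit⟩ (Nat.lt_succ_self i)
      omega
  -- Positions below `j` are padded with zeros. By `hge` the subtraction is not truncated elsewhere.
  set c : Fin t → ℕ := fun i => if j ≤ i + 1 then e (i + 1) - i else 0 with hcdef
  have hsum : ∀ f : ℕ → ℕ → ℕ, (∀ i < t, f i i = 0) →
      ∑ i : Fin t, f i (c i + i) = ∑ i ∈ Finset.Icc j t, f (i - 1) (e i) := by
    intro f hf
    have h1 : ∑ i : Fin t, f i (c i + i) =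
        ∑ i ∈ Finset.range t, if j ≤ i + 1 then f i (e (i + 1)) else 0 := by
      rw [Finset.sum_range]
      refine Finset.sum_congr rfl fun i _ => ?_
      simp only [hcdef]
      split_ifs with hji
      · rw [Nat.sub_add_cancel]
        have := hge (i + 1) hji i.2
        omega
      · rw [zero_add]
        exact hf i i.2
    rw [h1, ← Finset.sum_filter]
    refine Finset.sum_nbij' (fun i => i + 1) (fun i => i - 1) ?_ ?_ ?_ ?_ ?_
    all_goals
      simp only [Finset.mem_filter, Finset.mem_range, Finset.mem_Icc]
      intro i hi
    · omega
    · omega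
    · omega
    · omega
    · simp
  refine ⟨c, ?_, ?_, ?_⟩
  · intro i i' hii
    simp only [hcdef]
    split_ifs with h1 h2
    · have hii' : (i : ℕ) ≤ i' := hii
      have : ∀ k : ℕ, (i : ℕ) + k < t → e (i + 1) + k ≤ e (i + k + 1) := by
        intro k
        induction k with
        | zero => simp
        | succ k ih =>
          intro hk
          have h3 := ih (by omega)
          have h4 := hmono (a := i + k + 1) (b := i + (k + 1) + 1) ⟨by omega, by omega⟩
            ⟨by omega, by omega⟩ (by omega)
          omega
      have h5 := this (i' - i) (by omega)
      rw [show (i : ℕ) + (i' - i) + 1 = i' + 1 by omega] at h5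
      omega
    · have hii' : (i : ℕ) ≤ i' := hii
      omega
    · exact Nat.zero_le _
    · exact le_rfl
  · rw [digitSum, hsum (fun i x => x.choose (i + 1)) (by simp)]
    refine Finset.sum_congr rfl fun i hi => ?_
    rw [Nat.sub_add_cancel (by have := (Finset.mem_Icc.1 hi).1; omega)]
  · rw [digitSum_one_add_two, hsum (fun i x => (x + 1).choose (i + 2)) (by simp)]
    refine Finset.sum_congr rfl fun i hi => ?_
    rw [show i - 1 + 2 = i + 1 by have := (Finset.mem_Icc.1 hi).1; omega]

/-! ### Conjugation, stable families and M-vectors. -/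

/-- The conjugate of the partition with the parts `r j ≤ t`, as an increasing sequence. -/
def conj (t : ℕ) {d : ℕ} (r : Fin d → ℕ) : Fin t → ℕ :=
  fun i => (Finset.univ.filter fun j => t ≤ r j + i).card

theorem conj_mono (t : ℕ) {d : ℕ} {r r' : Fin d → ℕ} (h : r ≤ r') : conj t r ≤ conj t r' :=
  fun _ => Finset.card_le_card <| Finset.monotone_filter_right _ fun j _ hj =>
    hj.trans (Nat.add_le_add_right (h j) _)

theorem monotone_conj (t : ℕ) {d : ℕ} (r : Fin d → ℕ) : Monotone (conj t r) :=
  fun _ _ h => Finset.card_le_card <| Finset.monotone_filter_right _ fun _ _ hj =>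
    hj.trans (Nat.add_le_add_left h _)

theorem conj_le (t : ℕ) {d : ℕ} (r : Fin d → ℕ) (i : Fin t) : conj t r i ≤ d :=
  (Finset.card_le_univ _).trans (Fintype.card_fin d).le

/-- Since `r` is increasing, the indices counted by `conj` form a final segment, which contains `j`
exactly when it has at least `d - j` elements. The symmetry of the equivalence makes conjugation an
involution. -/
theorem le_conj_add_iff {t d : ℕ} {r : Fin d → ℕ} (hr : Monotone r) (i : Fin t) (j : Fin d) :
    d ≤ conj t r i + j ↔ t ≤ r j + i := by
  constructor
  · intro h
    by_contra hcon
    have : conj t r i ≤ (Finset.Ioi j).card := by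
      refine Finset.card_le_card fun j' hj' => ?_
      have h1 := (Finset.mem_filter.1 hj').2
      rw [Finset.mem_Ioi]
      by_contra h2
      have := hr (not_lt.1 h2)
      omega
    rw [Fin.card_Ioi] at this
    omega
  · intro h
    have : (Finset.Ici j).card ≤ conj t r i := by
      refine Finset.card_le_card fun j' hj' => Finset.mem_filter.2 ⟨Finset.mem_univ _, ?_⟩
      have := hr (Finset.mem_Ici.1 hj')
      omega
    rw [Fin.card_Ici] at this
    omega

theorem conj_conj {t d : ℕ} {r : Fin d → ℕ} (hr : Monotone r) (h : ∀ j, r j ≤ t) :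
    conj d (conj t r) = r := by
  ext j
  simp only [conj.eq_1 d, le_conj_add_iff hr]
  rcases Nat.eq_zero_or_pos (r j) with h0 | h0
  · rw [h0, Finset.card_eq_zero, Finset.filter_eq_empty_iff]
    intro i _
    omega
  · have hj := h j
    have : (Finset.univ.filter fun i : Fin t => t ≤ r j + i) =
        Finset.Ici ⟨t - r j, by omega⟩ := by
      ext i
      simp only [Finset.mem_filter, Finset.mem_univ, true_and, Finset.mem_Ici, Fin.le_def]
      omega
    rw [this, Fin.card_Ici]
    simp only
    omega

/-- A nonempty set of weakly increasing sequences of length `d + 1` with entries less than `n`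
that is closed under passing to smaller weakly increasing sequences. -/
structure IsStableFamily (n d : ℕ) (E : Set (Fin (d + 1) → ℕ)) : Prop where
  nonempty : E.Nonempty
  monotone : ∀ r ∈ E, Monotone r
  lt : ∀ r ∈ E, ∀ j, r j < n
  lower : ∀ r ∈ E, ∀ r', Monotone r' → r' ≤ r → r' ∈ E

/-- The bijection is `r ↦ conj t r - 1`: last entry `t` forces all entries of `conj t r` to be
positive, so subtracting 1 loses nothing. -/
theorem ncard_last_eq {d t : ℕ} {E : Set (Fin (d + 1) → ℕ)} {A : Set (Fin t → ℕ)}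
    (hE : ∀ r ∈ E, Monotone r)
    (hA : ∀ v, v ∈ A ↔ Monotone v ∧ (∀ i, v i < d + 1) ∧ conj (d + 1) (fun i => v i + 1) ∈ E) :
    {r | r ∈ E ∧ r (Fin.last d) = t}.ncard = A.ncard := by
  have hinv : ∀ v ∈ A, conj t (conj (d + 1) fun i => v i + 1) = fun i => v i + 1 := fun v hv =>
    conj_conj (fun i j h => Nat.add_le_add_right (((hA v).1 hv).1 h) 1) ((hA v).1 hv).2.1
  have hinj : Set.InjOn (fun v : Fin t → ℕ => conj (d + 1) fun i => v i + 1) A := by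
    intro v hv w hw h
    have h1 := (hinv v hv).symm.trans ((congrArg (conj t) h).trans (hinv w hw))
    ext i
    exact Nat.succ_injective (congrFun h1 i)
  rw [← hinj.ncard_image]
  congr 1
  ext r
  constructor
  · rintro ⟨hr, hlast⟩
    have hpos : ∀ i, 1 ≤ conj t r i := by
      intro i
      have := (le_conj_add_iff (hE r hr) i (Fin.last d)).2 (by omega)
      simp only [Fin.val_last] at this
      omega
    have heq : (fun i => conj t r i - 1 + 1) = conj t r := by
      ext i
      exact Nat.sub_add_cancel (hpos i)
    have hcc : conj (d + 1) (conj t r) = r :=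
      conj_conj (hE r hr) fun j => hlast ▸ hE r hr (Fin.le_last j)
    refine ⟨fun i => conj t r i - 1, (hA _).2
      ⟨fun i j h => Nat.sub_le_sub_right (monotone_conj t r h) 1, fun i => ?_, ?_⟩, ?_⟩
    · have := conj_le t r i
      have := hpos i
      omega
    · rw [heq, hcc]
      exact hr
    · simp only
      rw [heq, hcc]
  · rintro ⟨v, hv, rfl⟩
    refine ⟨((hA v).1 hv).2.2, ?_⟩
    simp only [conj]
    rw [Finset.filter_true_of_mem, Finset.card_univ, Fintype.card_fin]
    intro i _
    simp only [Fin.val_last]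
    omega

theorem IsStableFamily.isMVector {n d : ℕ} {E : Set (Fin (d + 1) → ℕ)}
    (hE : IsStableFamily n d E) {ℓ : Fin n → ℕ}
    (hℓ : ∀ k : Fin n, {r | r ∈ E ∧ r (Fin.last d) = k}.ncard = ℓ k) :
    IsMVector ℓ ∧ ∀ h2 : 1 < n, ℓ ⟨1, h2⟩ ≤ d + 1 := by
  let A : (t : ℕ) → Set (Fin t → ℕ) := fun t =>
    {v | Monotone v ∧ (∀ i, v i < d + 1) ∧ conj (d + 1) (fun i => v i + 1) ∈ E}
  have hcard : ∀ k : Fin n, (A k).ncard = ℓ k := fun k =>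
    (ncard_last_eq hE.monotone fun _ => Iff.rfl).symm.trans (hℓ k)
  obtain ⟨r, hr⟩ := hE.nonempty
  have h0 : (0 : Fin (d + 1) → ℕ) ∈ E := hE.lower r hr 0 monotone_const fun _ => Nat.zero_le _
  have hn : 0 < n := (Nat.zero_le _).trans_lt (hE.lt r hr 0)
  have hfin : ∀ t, (A t).Finite := fun t =>
    (Set.Finite.pi' fun _ : Fin t => Set.finite_Iio (d + 1)).subset fun v hv => hv.2.1
  have hA : ∀ t, IsStableFinset (hfin t).toFinset := by
    intro t v hv
    rw [Set.Finite.mem_toFinset] at hv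
    refine ⟨hv.1, fun w hw hwv => (Set.Finite.mem_toFinset _).2 ⟨hw, fun i =>
      (hwv i).trans_lt (hv.2.1 i), hE.lower _ hv.2.2 _ (monotone_conj _ _) (conj_mono _ fun i =>
      Nat.add_le_add_right (hwv i) 1)⟩⟩
  -- The entries of the conjugate count entries of `v`, so removing one can only lower them.
  have htail : ∀ t, ∀ v ∈ A (t + 1), Fin.tail v ∈ A t := by
    intro t v hv
    refine ⟨monotone_tail hv.1, fun i => hv.2.1 _,
      hE.lower _ hv.2.2 _ (monotone_conj _ _) fun j => ?_⟩
    exact Finset.card_le_card_of_injOn Fin.succ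
      (fun i hi => by
        rw [Finset.mem_coe, Finset.mem_filter] at hi ⊢
        exact ⟨Finset.mem_univ _, hi.2⟩) (Fin.succ_injective t).injOn
  refine ⟨⟨⟨hn, ?_⟩, fun t ht htn => ?_⟩, fun h2 => ?_⟩
  · rw [← hcard ⟨0, hn⟩, Set.ncard_eq_one]
    refine ⟨0, Set.eq_singleton_iff_unique_mem.2 ⟨⟨monotone_const, fun i => i.elim0, ?_⟩,
      fun v _ => Subsingleton.elim (α := Fin 0 → ℕ) _ _⟩⟩
    rw [show (conj (d + 1) fun i => (0 : Fin 0 → ℕ) i + 1) = 0 by ext j; simp [conj]]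
    exact h0
  · obtain ⟨s, rfl⟩ : ∃ s, t = s + 1 := ⟨t - 1, by omega⟩
    obtain ⟨c, hc, hcA⟩ := exists_digitSum_one_eq s (hfin (s + 1)).toFinset.card
    have h1 := macaulay_bound (hA (s + 1)) (B := (hfin (s + 2)).toFinset) (fun v hv => by
      rw [Set.Finite.mem_toFinset] at hv
      exact ⟨hv.1, (Set.Finite.mem_toFinset _).2 (htail _ v hv)⟩) hc hcA.symm
    refine ⟨digitSum 1 c + digitSum 2 c, ?_, ?_⟩
    · rw [← hcard, Set.ncard_eq_toFinset_card _ (hfin (s + 1)), ← hcA]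
      exact isMacaulayUpper_digitSum hc
    · rw [← hcard, Set.ncard_eq_toFinset_card _ (hfin (s + 2))]
      exact h1
  · rw [← hcard ⟨1, h2⟩]
    calc (A 1).ncard ≤ (Set.Iio (d + 1)).ncard := by
          refine Set.ncard_le_ncard_of_injOn (fun v : Fin 1 → ℕ => v 0) (fun v hv => hv.2.1 0)
            (fun v _ w _ h => ?_) (Set.finite_Iio _)
          ext i
          rw [Subsingleton.elim i 0]
          exact h
      _ = d + 1 := by rw [← Nat.card_coe_set_eq]; simp

/-- Every rank occurs exactly once when `t > 0`. For `t = 0` there is a single sequence, of rank 0,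
hence the hypothesis. -/
theorem ncard_digitSum_one_lt {t N : ℕ} (h : t = 0 → N = 1) :
    {v : Fin t → ℕ | Monotone v ∧ digitSum 1 v < N}.ncard = N := by
  have hinj : Set.InjOn (digitSum 1) {v : Fin t → ℕ | Monotone v ∧ digitSum 1 v < N} :=
    fun v hv w hw hvw => digitSum_one_injOn hv.1 hw.1 hvw
  rw [← hinj.ncard_image]
  have : digitSum 1 '' {v : Fin t → ℕ | Monotone v ∧ digitSum 1 v < N} = Set.Iio N := by
    ext a
    constructor
    · rintro ⟨v, hv, rfl⟩
      exact hv.2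
    · intro ha
      cases t with
      | zero =>
        have ha' : a < N := ha
        refine ⟨0, ⟨monotone_const, by simp [digitSum, h rfl]⟩, ?_⟩
        simp only [digitSum, Finset.univ_eq_empty, Finset.sum_empty]
        have := h rfl
        omega
      | succ t =>
        obtain ⟨c, hc, rfl⟩ := exists_digitSum_one_eq t a
        exact ⟨c, ⟨hc, ha⟩, rfl⟩
  rw [this, ← Nat.card_coe_set_eq]
  simp

theorem IsMVector.exists_isStableFamily {n d : ℕ} {ℓ : Fin n → ℕ} (h : IsMVector ℓ)
    (hd : ∀ h2 : 1 < n, ℓ ⟨1, h2⟩ ≤ d + 1) :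
    ∃ E : Set (Fin (d + 1) → ℕ), IsStableFamily n d E ∧
      ∀ k : Fin n, {r | r ∈ E ∧ r (Fin.last d) = k}.ncard = ℓ k := by
  obtain ⟨⟨hn, h0⟩, hM⟩ := h
  let H : ℕ → ℕ := fun t => if ht : t < n then ℓ ⟨t, ht⟩ else 0
  have H0 : H 0 = 1 := by simp only [H, dif_pos hn, h0]
  have H1 : H 1 ≤ d + 1 := by
    simp only [H]
    split_ifs with h2
    · exact hd h2
    · exact Nat.zero_le _
  -- Initial colexicographic segments are down-closed because ranks are monotone in the entries.
  let A : (t : ℕ) → Set (Fin t → ℕ) := fun t => {v | Monotone v ∧ digitSum 1 v < H t}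
  have hlower : ∀ t, ∀ v ∈ A t, ∀ w, Monotone w → w ≤ v → w ∈ A t := fun t v hv w hw hwv =>
    ⟨hw, (digitSum_mono 1 hwv).trans_lt hv.2⟩
  have htail : ∀ t, ∀ v ∈ A (t + 1), Fin.tail v ∈ A t := by
    rintro t v ⟨hv, hvH⟩
    refine ⟨monotone_tail hv, ?_⟩
    rcases Nat.eq_zero_or_pos t with rfl | ht
    · simp [digitSum, H0]
    · by_cases htn : t + 1 < n
      · obtain ⟨b, hb, hle⟩ := hM t ht htn
        obtain ⟨c, hc, hc1, rfl⟩ := hb.exists_digitSum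
        have e1 : H (t + 1) = ℓ ⟨t + 1, htn⟩ := dif_pos htn
        have e2 : H t = ℓ ⟨t, (Nat.lt_succ_self t).trans htn⟩ := dif_pos _
        rw [e2, ← hc1]
        by_contra hcon
        have h1 := digitSum_two_le_of_one_le hc (monotone_tail hv) (not_lt.1 hcon)
        have h2 := digitSum_tail_le v
        omega
      · have : H (t + 1) = 0 := dif_neg htn
        omega
  have hdrop : ∀ k t, ∀ v ∈ A (t + k), (fun i : Fin t => v ⟨i + k, by omega⟩) ∈ A t := by
    intro k t
    induction k with
    | zero => exact fun v hv => hv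
    | succ k ih => exact fun v hv => ih _ (htail _ v hv)
  -- The largest entry, kept alone, lies in `A 1`, where the rank is the entry itself and is below
  -- `H 1 ≤ d + 1`.
  have hlt : ∀ t, ∀ v ∈ A t, ∀ i, v i < d + 1 := by
    intro t v hv i
    obtain ⟨k, rfl⟩ : ∃ k, t = 1 + k := ⟨t - 1, by have := i.2; omega⟩
    have h1 := (hdrop k 1 v hv).2
    simp only [digitSum, Finset.univ_unique, Finset.sum_singleton] at h1
    simp only [Fin.default_eq_zero, Fin.val_zero, zero_add, add_zero, Nat.choose_one_right] at h1
    have h2 : v i ≤ v ⟨k, by omega⟩ := hv.1 (by have := i.2; rw [Fin.le_def]; simp only; omega)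
    omega
  let E : Set (Fin (d + 1) → ℕ) :=
    {r | Monotone r ∧ ∃ t, t < n ∧ r (Fin.last d) = t ∧ (fun i => conj t r i - 1) ∈ A t}
  have hAE : ∀ t, t < n → ∀ v, v ∈ A t ↔
      Monotone v ∧ (∀ i, v i < d + 1) ∧ conj (d + 1) (fun i => v i + 1) ∈ E := by
    intro t ht v
    have hlast : conj (d + 1) (fun i => v i + 1) (Fin.last d) = t := by
      simp only [conj]
      rw [Finset.filter_true_of_mem, Finset.card_univ, Fintype.card_fin]
      intro i _
      simp only [Fin.val_last]
      omega
    have hcc : Monotone v → (∀ i, v i < d + 1) →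
        (fun i => conj t (conj (d + 1) fun i => v i + 1) i - 1) = v := by
      intro h1 h2
      rw [conj_conj (fun i j hij => Nat.add_le_add_right (h1 hij) 1) h2]
      simp
    constructor
    · intro hv
      refine ⟨hv.1, hlt t v hv, monotone_conj _ _, t, ht, hlast, ?_⟩
      rw [hcc hv.1 (hlt t v hv)]
      exact hv
    · rintro ⟨h1, h2, -, s, -, hs, hsA⟩
      rw [hlast] at hs
      subst hs
      rwa [hcc h1 h2] at hsA
  refine ⟨E, ⟨⟨0, monotone_const, 0, hn, rfl, ?_⟩, fun r hr => hr.1, ?_, ?_⟩, fun k => ?_⟩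
  · exact ⟨fun i => i.elim0, by simp [digitSum, H0]⟩
  · rintro r ⟨hr, t, ht, hrt, -⟩ j
    exact (hr (Fin.le_last j)).trans_lt (hrt ▸ ht)
  · rintro r ⟨hr, t, ht, hrt, hrA⟩ r' hr' hle
    -- Lowering the last entry by `k` shortens the conjugate by `k`. The result lies below the
    -- conjugate of `r` with its first `k` entries dropped, so `hdrop` applies.
    obtain ⟨k, hk⟩ := Nat.exists_eq_add_of_le (hle (Fin.last d))
    rw [hrt] at hk
    subst hk
    refine ⟨hr', _, by omega, rfl, hlower _ _ (hdrop k _ _ hrA) _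
      (fun i j hij => Nat.sub_le_sub_right (monotone_conj _ _ hij) 1) fun i => ?_⟩
    refine Nat.sub_le_sub_right (Finset.card_le_card ?_) 1
    refine Finset.monotone_filter_right _ fun j _ hj => ?_
    have hj' : r' j ≤ r j := hle j
    change r' (Fin.last d) + k ≤ r j + (i + k)
    change r' (Fin.last d) ≤ r' j + i at hj
    omega
  · have hk : A k = {v | Monotone v ∧ digitSum 1 v < ℓ k} := by
      have : H k = ℓ k := dif_pos k.2
      rw [← this]
    rw [ncard_last_eq (fun r hr => hr.1) (hAE k k.2), hk]
    refine ncard_digitSum_one_lt fun hk0 => ?_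
    rw [← h0]
    congr 1
    exact Fin.ext hk0

/-! ### Monomials as sequences of variables. -/

/-- The monomial `∏ i, x_{ρ i}`. -/
noncomputable def seqMonomial {m d : ℕ} (ρ : Fin d → Fin m) : Fin m →₀ ℕ :=
  ∑ i, Finsupp.single (ρ i) 1

theorem degree_seqMonomial {m d : ℕ} (ρ : Fin d → Fin m) : (seqMonomial ρ).degree = d := by
  simp [seqMonomial, map_sum]

theorem seqMonomial_comp_perm {m d : ℕ} (ρ : Fin d → Fin m) (σ : Equiv.Perm (Fin d)) :
    seqMonomial (ρ ∘ σ) = seqMonomial ρ :=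
  Equiv.sum_comp σ fun i => Finsupp.single (ρ i) 1

theorem exists_monotone_seqMonomial_eq {m d : ℕ} {u : Fin m →₀ ℕ} (hu : u.degree = d) :
    ∃ ρ : Fin d → Fin m, Monotone ρ ∧ seqMonomial ρ = u := by
  suffices h : ∃ ρ : Fin d → Fin m, seqMonomial ρ = u by
    obtain ⟨ρ, rfl⟩ := h
    exact ⟨ρ ∘ Tuple.sort ρ, Tuple.monotone_sort ρ, seqMonomial_comp_perm _ _⟩
  induction d generalizing u with
  | zero =>
    refine ⟨Fin.elim0, ?_⟩
    rw [(Finsupp.degree_eq_zero_iff u).1 hu]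
    simp [seqMonomial]
  | succ d ih =>
    have hne : u ≠ 0 := by
      rintro rfl
      simp at hu
    obtain ⟨q, hq⟩ := Finsupp.ne_iff.1 hne
    have hle : Finsupp.single q 1 ≤ u :=
      Finsupp.single_le_iff.2 (Nat.one_le_iff_ne_zero.2 hq)
    have hdeg : (u - Finsupp.single q 1).degree = d := by
      have := congrArg Finsupp.degree (tsub_add_cancel_of_le hle)
      rw [map_add, Finsupp.degree_single, hu] at this
      omega
    obtain ⟨ρ, hρ⟩ := ih hdeg
    refine ⟨Fin.cons q ρ, ?_⟩
    rw [← tsub_add_cancel_of_le hle, ← hρ]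
    simp [seqMonomial, Fin.sum_univ_succ, add_comm]

theorem seqMonomial_injOn {m d : ℕ} {ρ ρ' : Fin d → Fin m} (hρ : Monotone ρ) (hρ' : Monotone ρ')
    (h : seqMonomial ρ = seqMonomial ρ') : ρ = ρ' := by
  have key : ∀ τ : Fin d → Fin m, Finsupp.toMultiset (seqMonomial τ) = ↑(List.ofFn τ) := by
    intro τ
    rw [← Fin.univ_val_map, seqMonomial, map_sum]
    simp only [Finsupp.toMultiset_single, one_smul]
    have := Multiset.sum_map_singleton (Multiset.map τ Finset.univ.val)
    rwa [Multiset.map_map] at this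
  have h1 : ((List.ofFn ρ : List (Fin m)) : Multiset (Fin m)) = ↑(List.ofFn ρ') := by
    rw [← key, ← key, h]
  exact List.ofFn_injective
    ((Multiset.coe_eq_coe.1 h1).eq_of_sortedLE hρ.sortedLE_ofFn hρ'.sortedLE_ofFn)

theorem mem_support_seqMonomial {m d : ℕ} (ρ : Fin d → Fin m) (q : Fin m) :
    q ∈ (seqMonomial ρ).support ↔ ∃ k, ρ k = q := by
  rw [Finsupp.mem_support_iff, seqMonomial, Finsupp.finsetSum_apply, Ne, Finset.sum_eq_zero_iff]
  simp [Finsupp.single_apply]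

theorem seqMonomial_eq_add {m d : ℕ} {ρ ρ' : Fin d → Fin m} (k : Fin d)
    (h : ∀ i, i ≠ k → ρ' i = ρ i) : ∃ w, seqMonomial ρ = w + Finsupp.single (ρ k) 1 ∧
      seqMonomial ρ' = w + Finsupp.single (ρ' k) 1 := by
  refine ⟨∑ i ∈ Finset.univ.erase k, Finsupp.single (ρ i) 1,
    (Finset.sum_erase_add _ _ (Finset.mem_univ k)).symm, ?_⟩
  rw [seqMonomial, ← Finset.sum_erase_add _ _ (Finset.mem_univ k)]
  congr 1
  exact Finset.sum_congr rfl fun i hi => by rw [h i (Finset.ne_of_mem_erase hi)]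

theorem isSquarefreeMonomial_seqMonomial {m d : ℕ} {ρ : Fin d → Fin m} :
    IsSquarefreeMonomial (seqMonomial ρ) ↔ Function.Injective ρ := by
  have key : ∀ q, seqMonomial ρ q = (Finset.univ.filter fun i => ρ i = q).card := by
    intro q
    rw [seqMonomial, Finsupp.finsetSum_apply, Finset.card_filter]
    exact Finset.sum_congr rfl fun i _ => by simp [Finsupp.single_apply]
  simp only [IsSquarefreeMonomial, key, Finset.card_le_one, Finset.mem_filter, Finset.mem_univ,
    true_and]
  exact ⟨fun h i j hij => h (ρ j) i hij j rfl, fun h q i hi j hj => h (hi.trans hj.symm)⟩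

theorem maxVar_seqMonomial {m d : ℕ} {ρ : Fin (d + 1) → Fin m} (hρ : Monotone ρ) :
    maxVar (seqMonomial ρ) = ρ (Fin.last d) + 1 := by
  apply le_antisymm
  · refine Finset.sup_le fun q hq => ?_
    obtain ⟨k, rfl⟩ := (mem_support_seqMonomial ρ q).1 hq
    exact Nat.add_le_add_right (hρ (Fin.le_last k)) 1
  · exact Finset.le_sup (f := fun i : Fin m => (i : ℕ) + 1)
      ((mem_support_seqMonomial ρ _).2 ⟨_, rfl⟩)

/-- Pigeonhole: if the sorted `τ` exceeded `ρ` at `i`, the positions from `i` on would all come from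
original indices beyond `i`, and there are too few of those. -/
theorem comp_sort_le {m d : ℕ} {ρ τ : Fin d → Fin m} (hρ : Monotone ρ) (h : τ ≤ ρ) :
    τ ∘ Tuple.sort τ ≤ ρ := by
  intro i
  by_contra hcon
  rw [not_le] at hcon
  have h1 : ∀ j ∈ Finset.Ici i, Tuple.sort τ j ∈ Finset.Ioi i := by
    intro j hj
    rw [Finset.mem_Ioi]
    by_contra hji
    have h2 : τ (Tuple.sort τ i) ≤ τ (Tuple.sort τ j) :=
      Tuple.monotone_sort τ (Finset.mem_Ici.1 hj)
    exact absurd (hcon.trans_le (h2.trans ((h _).trans (hρ (not_lt.1 hji))))) (lt_irrefl _)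
  have h2 := Finset.card_le_card_of_injOn _ h1 (Tuple.sort τ).injective.injOn
  rw [Fin.card_Ici, Fin.card_Ioi] at h2
  have := i.2
  omega

/-- `ρ` arises from `r` by spreading out consecutive entries by `e`. -/
def IsSpread (e : ℕ) {m d : ℕ} (r : Fin d → ℕ) (ρ : Fin d → Fin m) : Prop :=
  ∀ i, (ρ i : ℕ) = r i + e * i

theorem IsSpread.monotone {e m d : ℕ} {r : Fin d → ℕ} {ρ : Fin d → Fin m} (h : IsSpread e r ρ)
    (hr : Monotone r) : Monotone ρ := fun i j hij => by
  rw [Fin.le_def, h i, h j]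
  exact add_le_add (hr hij) (Nat.mul_le_mul_left _ hij)

theorem IsSpread.injective {m d : ℕ} {r : Fin d → ℕ} {ρ : Fin d → Fin m} (h : IsSpread 1 r ρ)
    (hr : Monotone r) : Function.Injective ρ := by
  refine StrictMono.injective fun i j hij => ?_
  rw [Fin.lt_def, h i, h j]
  have h1 := hr hij.le
  have h2 : (i : ℕ) < j := hij
  omega

theorem exists_isSpread_zero {m d : ℕ} {ρ : Fin d → Fin m} (hρ : Monotone ρ) :
    ∃ r : Fin d → ℕ, Monotone r ∧ IsSpread 0 r ρ :=
  ⟨fun i => ρ i, fun _ _ h => hρ h, fun i => by simp⟩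

theorem exists_isSpread_one {m d : ℕ} {ρ : Fin d → Fin m} (hρ : Monotone ρ)
    (hinj : Function.Injective ρ) : ∃ r : Fin d → ℕ, Monotone r ∧ IsSpread 1 r ρ := by
  have hs : StrictMono ρ := hρ.strictMono_of_injective hinj
  have hge : ∀ i : ℕ, ∀ hi : i < d, i ≤ (ρ ⟨i, hi⟩ : ℕ) := by
    intro i
    induction i with
    | zero => exact fun _ => Nat.zero_le _
    | succ i ih =>
      intro hi
      have h1 := ih (by omega)
      have h2 : ρ ⟨i, by omega⟩ < ρ ⟨i + 1, hi⟩ := hs (by simp)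
      rw [Fin.lt_def] at h2
      omega
  have hstep : ∀ k i : ℕ, ∀ hi : i + k < d,
      (ρ ⟨i, by omega⟩ : ℕ) + k ≤ ρ ⟨i + k, hi⟩ := by
    intro k
    induction k with
    | zero => exact fun _ _ => le_rfl
    | succ k ih =>
      intro i hi
      have h1 := ih i (by omega)
      have h2 : ρ ⟨i + k, by omega⟩ < ρ ⟨i + (k + 1), hi⟩ := hs (by simp)
      rw [Fin.lt_def] at h2
      omega
  refine ⟨fun i => ρ i - i, fun i j hij => ?_, fun i => ?_⟩
  · have hij' : (i : ℕ) ≤ j := hij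
    have h1 := hstep (j - i) i (by omega)
    simp only [Nat.add_sub_cancel' hij', Fin.eta] at h1
    simp only
    omega
  · have h1 : (i : ℕ) ≤ ρ i := hge i i.2
    change (ρ i : ℕ) = ρ i - i + 1 * i
    omega

/-! ### Stable families and stable sets of monomials. -/

/-- The set of monomials that corresponds to a set of sequences. -/
def monomialsOf (e m : ℕ) {d : ℕ} (E : Set (Fin d → ℕ)) : Set (Fin m →₀ ℕ) :=
  {u | ∃ r ∈ E, ∃ ρ : Fin d → Fin m, IsSpread e r ρ ∧ seqMonomial ρ = u}

theorem exists_isSpread {e n d m : ℕ} (hm : m = n + e * d) {r : Fin (d + 1) → ℕ}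
    (hr : ∀ j, r j < n) : ∃ ρ : Fin (d + 1) → Fin m, IsSpread e r ρ := by
  refine ⟨fun i => ⟨r i + e * i, ?_⟩, fun i => rfl⟩
  have h1 := hr i
  have h2 : e * (i : ℕ) ≤ e * d := Nat.mul_le_mul_left _ (Nat.lt_succ_iff.1 i.2)
  omega

theorem ncard_monomialsOf {e n d m : ℕ} (hm : m = n + e * d) {E : Set (Fin (d + 1) → ℕ)}
    (hE : IsStableFamily n d E) (k : ℕ) :
    {u | u ∈ monomialsOf e m E ∧ maxVar u = k + e * d + 1}.ncard =
      {r | r ∈ E ∧ r (Fin.last d) = k}.ncard := by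
  have hmax : ∀ r ∈ E, ∀ ρ : Fin (d + 1) → Fin m, IsSpread e r ρ →
      maxVar (seqMonomial ρ) = r (Fin.last d) + e * d + 1 := by
    intro r hr ρ hρ
    rw [maxVar_seqMonomial (hρ.monotone (hE.monotone r hr)), hρ, Fin.val_last]
  symm
  refine Set.ncard_congr
    (fun r hr => seqMonomial (exists_isSpread hm (hE.lt r hr.1)).choose) ?_ ?_ ?_
  · intro r hr
    have hs := (exists_isSpread hm (hE.lt r hr.1)).choose_spec
    exact ⟨⟨r, hr.1, _, hs, rfl⟩, by rw [hmax r hr.1 _ hs, hr.2]⟩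
  · intro r r' hr hr' h
    have hs := (exists_isSpread hm (hE.lt r hr.1)).choose_spec
    have hs' := (exists_isSpread hm (hE.lt r' hr'.1)).choose_spec
    have h1 := seqMonomial_injOn (hs.monotone (hE.monotone r hr.1))
      (hs'.monotone (hE.monotone r' hr'.1)) h
    ext i
    have h2 := hs i
    rw [h1, hs' i] at h2
    omega
  · rintro u ⟨⟨r, hr, ρ, hρ, rfl⟩, hu⟩
    rw [hmax r hr ρ hρ] at hu
    refine ⟨r, ⟨hr, by omega⟩, ?_⟩
    have hs := (exists_isSpread hm (hE.lt r hr)).choose_spec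
    congr 1
    ext i
    rw [hs i, hρ i]

/-- A set of monomials that is closed under lowering a single entry of the corresponding
sequences comes from a stable family. -/
theorem exists_isStableFamily_of_step {e n d m : ℕ} (hm : m = n + e * d)
    {V : Set (Fin m →₀ ℕ)} (hne : V.Nonempty)
    (hrep : ∀ u ∈ V, ∃ (r : Fin (d + 1) → ℕ) (ρ : Fin (d + 1) → Fin m),
      Monotone r ∧ IsSpread e r ρ ∧ seqMonomial ρ = u)
    (hstep : ∀ (r r' : Fin (d + 1) → ℕ) (ρ ρ' : Fin (d + 1) → Fin m) (k : Fin (d + 1)),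
      Monotone r → Monotone r' → IsSpread e r ρ → IsSpread e r' ρ' →
      (∀ i, i ≠ k → ρ' i = ρ i) → ρ' k < ρ k → seqMonomial ρ ∈ V → seqMonomial ρ' ∈ V) :
    ∃ E : Set (Fin (d + 1) → ℕ), IsStableFamily n d E ∧ monomialsOf e m E = V := by
  have hlower : ∀ (r r' : Fin (d + 1) → ℕ) (ρ ρ' : Fin (d + 1) → Fin m), Monotone r →
      Monotone r' → IsSpread e r ρ → IsSpread e r' ρ' → r' ≤ r → seqMonomial ρ ∈ V →
      seqMonomial ρ' ∈ V := by
    intro r r' ρ ρ' hr hr' hρ hρ' hle hV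
    -- Interpolate from `r` to `r'` one position at a time from the left; since `r' ≤ r`, every
    -- intermediate sequence stays increasing.
    let s : ℕ → Fin (d + 1) → ℕ := fun N i => if (i : ℕ) < N then r' i else r i
    let τ : ℕ → Fin (d + 1) → Fin m := fun N i => if (i : ℕ) < N then ρ' i else ρ i
    have hs : ∀ N, Monotone (s N) := by
      intro N i j hij
      have hij' : (i : ℕ) ≤ j := hij
      simp only [s]
      split_ifs with h1 h2
      · exact hr' hij
      · exact (hle i).trans (hr hij)
      · omega
      · exact hr hij
    have hτ : ∀ N, IsSpread e (s N) (τ N) := by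
      intro N i
      simp only [s, τ]
      split_ifs
      · exact hρ' i
      · exact hρ i
    have hmem : ∀ N, seqMonomial (τ N) ∈ V := by
      intro N
      induction N with
      | zero =>
        have : τ 0 = ρ := by
          ext i
          simp [τ]
        rwa [this]
      | succ N ih =>
        have hsame : ∀ i : Fin (d + 1), (i : ℕ) ≠ N → τ (N + 1) i = τ N i := by
          intro i hi
          simp only [τ, show ((i : ℕ) < N + 1) ↔ ((i : ℕ) < N) by omega]
        by_cases hN : N < d + 1
        · have hle' : τ (N + 1) ⟨N, hN⟩ ≤ τ N ⟨N, hN⟩ := by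
            simp only [τ, Nat.lt_succ_self, lt_irrefl, if_true, if_false]
            rw [Fin.le_def, hρ, hρ']
            exact Nat.add_le_add_right (hle _) _
          rcases hle'.lt_or_eq with hlt | heq
          · exact hstep _ _ _ _ ⟨N, hN⟩ (hs N) (hs (N + 1)) (hτ N) (hτ (N + 1))
              (fun i hi => hsame i fun h => hi (Fin.ext h)) hlt ih
          · have : τ (N + 1) = τ N := by
              funext i
              by_cases hi : (i : ℕ) = N
              · rw [show i = ⟨N, hN⟩ from Fin.ext hi, heq]
              · exact hsame i hi
            rwa [this]
        · have : τ (N + 1) = τ N := by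
            funext i
            exact hsame i (by omega)
          rwa [this]
    have : τ (d + 1) = ρ' := by
      funext i
      exact if_pos i.2
    rw [← this]
    exact hmem _
  have hlt : ∀ (r : Fin (d + 1) → ℕ) (ρ : Fin (d + 1) → Fin m), Monotone r → IsSpread e r ρ →
      ∀ j, r j < n := by
    intro r ρ hr hρ j
    have h1 := hρ (Fin.last d)
    have h2 := (ρ (Fin.last d)).2
    rw [Fin.val_last] at h1
    have h3 := hr (Fin.le_last j)
    omega
  refine ⟨{r | Monotone r ∧ ∃ ρ : Fin (d + 1) → Fin m, IsSpread e r ρ ∧ seqMonomial ρ ∈ V},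
    ⟨?_, fun r hr => hr.1, ?_, ?_⟩, ?_⟩
  · obtain ⟨u, hu⟩ := hne
    obtain ⟨r, ρ, hr, hρ, rfl⟩ := hrep u hu
    exact ⟨r, hr, ρ, hρ, hu⟩
  · rintro r ⟨hr, ρ, hρ, -⟩
    exact hlt r ρ hr hρ
  · rintro r ⟨hr, ρ, hρ, hV⟩ r' hr' hle
    obtain ⟨ρ', hρ'⟩ := exists_isSpread (e := e) hm
      fun j => (hle j).trans_lt (hlt r ρ hr hρ j)
    exact ⟨hr', ρ', hρ', hlower r r' ρ ρ' hr hr' hρ hρ' hle hV⟩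
  · ext u
    constructor
    · rintro ⟨r, ⟨hr, ρ', hρ', hV⟩, ρ, hρ, rfl⟩
      have : ρ = ρ' := by
        ext i
        rw [hρ i, hρ' i]
      rwa [this]
    · intro hu
      obtain ⟨r, ρ, hr, hρ, rfl⟩ := hrep u hu
      exact ⟨r, ⟨hr, ρ, hρ, hu⟩, ρ, hρ, rfl⟩

theorem IsStronglyStableSet.exists_isStableFamily {n d : ℕ} {V : Set (Fin n →₀ ℕ)}
    (hV : IsStronglyStableSet V) (hne : V.Nonempty) (hdeg : ∀ u ∈ V, u.degree = d + 1) :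
    ∃ E : Set (Fin (d + 1) → ℕ), IsStableFamily n d E ∧ monomialsOf 0 n E = V := by
  refine exists_isStableFamily_of_step (by simp) hne (fun u hu => ?_) ?_
  · obtain ⟨ρ, hρ, rfl⟩ := exists_monotone_seqMonomial_eq (hdeg u hu)
    obtain ⟨r, hr, hs⟩ := exists_isSpread_zero hρ
    exact ⟨r, ρ, hr, hs, rfl⟩
  · intro r r' ρ ρ' k _ _ _ _ hsame hlt hmem
    obtain ⟨w, h1, h2⟩ := seqMonomial_eq_add k hsame
    rw [h1] at hmem
    rw [h2]
    exact hV w _ _ hlt hmem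

theorem IsSquarefreeStronglyStableSet.exists_isStableFamily {n d m : ℕ} (hm : m = n + 1 * d)
    {V : Set (Fin m →₀ ℕ)} (hV : IsSquarefreeStronglyStableSet V) (hne : V.Nonempty)
    (hdeg : ∀ u ∈ V, u.degree = d + 1) (hsq : ∀ u ∈ V, IsSquarefreeMonomial u) :
    ∃ E : Set (Fin (d + 1) → ℕ), IsStableFamily n d E ∧ monomialsOf 1 m E = V := by
  refine exists_isStableFamily_of_step hm hne (fun u hu => ?_) ?_
  · obtain ⟨ρ, hρ, rfl⟩ := exists_monotone_seqMonomial_eq (hdeg u hu)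
    obtain ⟨r, hr, hs⟩ :=
      exists_isSpread_one hρ (isSquarefreeMonomial_seqMonomial.1 (hsq _ hu))
    exact ⟨r, ρ, hr, hs, rfl⟩
  · intro r r' ρ ρ' k hr hr' hs hs' hsame hlt hmem
    obtain ⟨w, h1, h2⟩ := seqMonomial_eq_add k hsame
    have h3 := hV _ hmem (ρ' k) (ρ k) hlt (fun h => ?_)
      ((mem_support_seqMonomial ρ _).2 ⟨k, rfl⟩)
    · rw [h1, add_tsub_cancel_right] at h3
      rwa [h2]
    -- If the new variable already occurred at another position, `ρ'` would repeat it, although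
    -- spread sequences are injective.
    · obtain ⟨j, hj⟩ := (mem_support_seqMonomial ρ _).1 h
      rcases eq_or_ne j k with rfl | hjk
      · exact hlt.ne hj.symm
      · rw [← hsame j hjk] at hj
        exact hjk (hs'.injective hr' hj)

/-- Replace one occurrence of `q` by `p` and sort again; by `comp_sort_le` the result lies below the
original sequence. -/
theorem IsStableFamily.isStronglyStableSet {n d : ℕ} {E : Set (Fin (d + 1) → ℕ)}
    (hE : IsStableFamily n d E) : IsStronglyStableSet (monomialsOf 0 n E) := by
  rintro u p q hpq ⟨r, hr, ρ, hρ, hu⟩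
  obtain ⟨k, hk⟩ := (mem_support_seqMonomial ρ q).1 (by rw [hu]; simp)
  obtain ⟨w, h1, h2⟩ := seqMonomial_eq_add (ρ := ρ) (ρ' := Function.update ρ k p) k
    fun i hi => Function.update_of_ne hi _ _
  rw [Function.update_self] at h2
  rw [hu, hk] at h1
  have hle : Function.update ρ k p ≤ ρ :=
    update_le_self_iff.2 (hk ▸ hpq.le)
  have hle' := comp_sort_le (hρ.monotone (hE.monotone r hr)) hle
  obtain ⟨r', hr', hs'⟩ := exists_isSpread_zero (Tuple.monotone_sort (Function.update ρ k p))
  refine ⟨r', hE.lower r hr r' hr' fun i => ?_, _, hs', ?_⟩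
  · have h3 : ((Function.update ρ k p ∘ Tuple.sort (Function.update ρ k p)) i : ℕ) ≤ ρ i :=
      hle' i
    rw [hs' i, hρ i] at h3
    exact Nat.le_of_add_le_add_right h3
  · rw [seqMonomial_comp_perm, h2, add_right_cancel h1]

theorem IsStableFamily.isSquarefreeStronglyStableSet {n d m : ℕ} {E : Set (Fin (d + 1) → ℕ)}
    (hE : IsStableFamily n d E) : IsSquarefreeStronglyStableSet (monomialsOf 1 m E) := by
  rintro _ ⟨r, hr, ρ, hρ, rfl⟩ p q hpq hp hq
  obtain ⟨k, hk⟩ := (mem_support_seqMonomial ρ q).1 hq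
  obtain ⟨w, h1, h2⟩ := seqMonomial_eq_add (ρ := ρ) (ρ' := Function.update ρ k p) k
    fun i hi => Function.update_of_ne hi _ _
  rw [Function.update_self] at h2
  rw [hk] at h1
  have hle : Function.update ρ k p ≤ ρ :=
    update_le_self_iff.2 (hk ▸ hpq.le)
  have hle' := comp_sort_le (hρ.monotone (hE.monotone r hr)) hle
  have hinj : Function.Injective (Function.update ρ k p) := by
    have hne : ∀ i, ρ i ≠ p := fun i hi => hp ((mem_support_seqMonomial ρ p).2 ⟨i, hi⟩)
    intro i j hij
    by_cases hi : i = k <;> by_cases hj : j = k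
    · exact hi.trans hj.symm
    · subst hi
      rw [Function.update_self, Function.update_of_ne hj] at hij
      exact absurd hij.symm (hne j)
    · subst hj
      rw [Function.update_self, Function.update_of_ne hi] at hij
      exact absurd hij (hne i)
    · rw [Function.update_of_ne hi, Function.update_of_ne hj] at hij
      exact hρ.injective (hE.monotone r hr) hij
  obtain ⟨r', hr', hs'⟩ := exists_isSpread_one (Tuple.monotone_sort (Function.update ρ k p))
    (hinj.comp (Tuple.sort (Function.update ρ k p)).injective)
  refine ⟨r', hE.lower r hr r' hr' fun i => ?_, _, hs', ?_⟩
  · have h3 : ((Function.update ρ k p ∘ Tuple.sort (Function.update ρ k p)) i : ℕ) ≤ ρ i :=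
      hle' i
    rw [hs' i, hρ i] at h3
    exact Nat.le_of_add_le_add_right h3
  · rw [seqMonomial_comp_perm, h2, h1, add_tsub_cancel_right]

/-! ### Monomial ideals generated in one degree. -/

theorem mem_monomialsIn_span {K : Type*} [Field K] {m : ℕ} {V : Set (Fin m →₀ ℕ)}
    {u : Fin m →₀ ℕ} :
    u ∈ monomialsIn (Ideal.span ((fun u => MvPolynomial.monomial u (1 : K)) '' V)) ↔
      ∃ v ∈ V, v ≤ u := by
  classical
  change MvPolynomial.monomial u (1 : K) ∈ Ideal.span _ ↔ _
  rw [MvPolynomial.mem_ideal_span_monomial_image, MvPolynomial.support_monomial,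
    if_neg one_ne_zero]
  simp

theorem IsMonomialIdeal.monomial_mem_of_mem_support {K : Type*} [Field K] {m : ℕ}
    {I : Ideal (MvPolynomial (Fin m) K)} (hI : IsMonomialIdeal I)
    {f : MvPolynomial (Fin m) K} (hf : f ∈ I) {u : Fin m →₀ ℕ} (hu : u ∈ f.support) :
    u ∈ monomialsIn I := by
  obtain ⟨V, rfl⟩ := hI
  exact mem_monomialsIn_span.2 (MvPolynomial.mem_ideal_span_monomial_image.1 hf u hu)

theorem IsMonomialIdeal.eq_span_of_isGeneratedInDegree {K : Type*} [Field K] {m d : ℕ}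
    {I : Ideal (MvPolynomial (Fin m) K)} (hI : IsMonomialIdeal I)
    (hd : IsGeneratedInDegree I d) :
    I = Ideal.span ((fun u => MvPolynomial.monomial u (1 : K)) ''
      {u | u ∈ monomialsIn I ∧ u.degree = d}) := by
  apply le_antisymm
  · obtain ⟨F, hF, hIF⟩ := hd
    have hFI : ∀ f ∈ F, f ∈ I := fun f hf => hIF ▸ Ideal.subset_span hf
    conv_lhs => rw [hIF]
    rw [Ideal.span_le]
    intro f hf
    refine MvPolynomial.mem_ideal_span_monomial_image.2 fun u hu => ⟨u, ⟨?_, ?_⟩, le_rfl⟩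
    · exact hI.monomial_mem_of_mem_support (hFI f hf) hu
    · by_contra hne
      exact MvPolynomial.mem_support_iff.1 hu ((hF f hf).coeff_eq_zero hne)
  · rw [Ideal.span_le]
    rintro _ ⟨u, hu, rfl⟩
    exact hu.1

theorem eq_of_le_of_degree_eq {m : ℕ} {u v : Fin m →₀ ℕ} (h : v ≤ u)
    (hd : u.degree = v.degree) : v = u := by
  have h1 := congrArg Finsupp.degree (tsub_add_cancel_of_le h)
  rw [map_add, hd] at h1
  have h2 : u - v = 0 := (Finsupp.degree_eq_zero_iff _).1 (by omega)
  exact le_antisymm h (tsub_eq_zero_iff_le.1 h2)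

theorem minGens_span {K : Type*} [Field K] {m d : ℕ} {V : Set (Fin m →₀ ℕ)}
    (hV : ∀ u ∈ V, u.degree = d) :
    minGens (Ideal.span ((fun u => MvPolynomial.monomial u (1 : K)) '' V)) = V := by
  ext u
  constructor
  · rintro ⟨hu, hmin⟩
    obtain ⟨v, hv, hvu⟩ := mem_monomialsIn_span.1 hu
    rwa [← le_antisymm hvu (hmin (mem_monomialsIn_span.2 ⟨v, hv, le_rfl⟩) hvu)]
  · refine fun hu => ⟨mem_monomialsIn_span.2 ⟨u, hu, le_rfl⟩, fun w hw hwu => ?_⟩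
    obtain ⟨v, hv, hvw⟩ := mem_monomialsIn_span.1 hw
    exact (eq_of_le_of_degree_eq (hvw.trans hwu) ((hV u hu).trans (hV v hv).symm)).ge.trans hvw

theorem isGeneratedInDegree_span {K : Type*} [Field K] {m d : ℕ} {V : Set (Fin m →₀ ℕ)}
    (hV : ∀ u ∈ V, u.degree = d) :
    IsGeneratedInDegree (Ideal.span ((fun u => MvPolynomial.monomial u (1 : K)) '' V)) d := by
  refine ⟨_, ?_, rfl⟩
  rintro _ ⟨u, hu, rfl⟩
  exact MvPolynomial.isHomogeneous_monomial _ (hV u hu)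

theorem span_monomials_ne_bot {K : Type*} [Field K] {m : ℕ} {V : Set (Fin m →₀ ℕ)} :
    Ideal.span ((fun u => MvPolynomial.monomial u (1 : K)) '' V) ≠ ⊥ ↔ V.Nonempty := by
  rw [Ne, Ideal.span_eq_bot, ← not_iff_comm]
  rw [Set.not_nonempty_iff_eq_empty]
  constructor
  · rintro rfl
    simp
  · intro h
    refine Set.eq_empty_iff_forall_notMem.2 fun u hu => ?_
    exact one_ne_zero (MvPolynomial.monomial_eq_zero.1 (h _ ⟨u, hu, rfl⟩))

theorem IsStronglyStableSet.span {K : Type*} [Field K] {m : ℕ} {V : Set (Fin m →₀ ℕ)}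
    (hV : IsStronglyStableSet V) :
    IsStronglyStable (Ideal.span ((fun u => MvPolynomial.monomial u (1 : K)) '' V)) := by
  refine ⟨⟨V, rfl⟩, fun u p q hpq hu => mem_monomialsIn_span.2 ?_⟩
  obtain ⟨v, hv, hvu⟩ := mem_monomialsIn_span.1 hu
  by_cases hq : Finsupp.single q 1 ≤ v
  · refine ⟨v - Finsupp.single q 1 + Finsupp.single p 1, hV _ p q hpq ?_, ?_⟩
    · rwa [tsub_add_cancel_of_le hq]
    · exact add_le_add_left (tsub_le_iff_right.2 hvu) _
  · refine ⟨v, hv, le_add_right fun i => ?_⟩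
    have h1 := hvu i
    rw [Finsupp.single_le_iff] at hq
    rcases eq_or_ne i q with rfl | hi
    · omega
    · simpa [Finsupp.single_apply, hi.symm] using h1

theorem IsSquarefreeStronglyStableSet.span {K : Type*} [Field K] {m : ℕ}
    {V : Set (Fin m →₀ ℕ)} (hV : IsSquarefreeStronglyStableSet V)
    (hsq : ∀ u ∈ V, IsSquarefreeMonomial u) :
    IsSquarefreeStronglyStable (Ideal.span ((fun u => MvPolynomial.monomial u (1 : K)) '' V)) := by
  refine ⟨⟨V, hsq, rfl⟩, ?_⟩
  rintro u ⟨hu, husq⟩ p q hpq hp hq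
  refine ⟨mem_monomialsIn_span.2 ?_, fun i => ?_⟩
  · obtain ⟨v, hv, hvu⟩ := mem_monomialsIn_span.1 hu
    by_cases hqv : q ∈ v.support
    · refine ⟨_, hV v hv p q hpq (fun h => hp ?_) hqv,
        add_le_add_left (tsub_le_tsub_right hvu _) _⟩
      rw [Finsupp.mem_support_iff] at h ⊢
      have := hvu p
      omega
    · refine ⟨v, hv, le_add_right fun i => ?_⟩
      have h1 := hvu i
      rw [Finsupp.notMem_support_iff] at hqv
      rcases eq_or_ne i q with rfl | hi
      · omega
      · simpa [Finsupp.single_apply, hi.symm] using h1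
  · have h1 := husq i
    rw [Finsupp.notMem_support_iff] at hp
    rcases eq_or_ne i p with rfl | hi
    · simp [Finsupp.single_apply, hp]
    · simp only [Finsupp.coe_add, Finsupp.coe_tsub, Pi.add_apply, Pi.sub_apply,
        Finsupp.single_apply, if_neg hi.symm]
      omega

theorem IsSquarefreeMonomialIdeal.isMonomialIdeal {K : Type*} [Field K] {m : ℕ}
    {I : Ideal (MvPolynomial (Fin m) K)} (hI : IsSquarefreeMonomialIdeal I) :
    IsMonomialIdeal I := by
  obtain ⟨V, -, rfl⟩ := hI
  exact ⟨V, rfl⟩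

/-- A squarefree generator `v` divides `u` and is itself divisible by some `w ∈ I` of degree `d`.
Equal degrees force `w = u`, hence `v = u`. -/
theorem IsSquarefreeMonomialIdeal.isSquarefreeMonomial {K : Type*} [Field K] {m d : ℕ}
    {I : Ideal (MvPolynomial (Fin m) K)} (hI : IsSquarefreeMonomialIdeal I)
    (hd : IsGeneratedInDegree I d) {u : Fin m →₀ ℕ} (hu : u ∈ monomialsIn I)
    (hud : u.degree = d) : IsSquarefreeMonomial u := by
  have hspan := hI.isMonomialIdeal.eq_span_of_isGeneratedInDegree hd
  obtain ⟨V, hV, rfl⟩ := hI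
  obtain ⟨v, hv, hvu⟩ := mem_monomialsIn_span.1 hu
  have hvI := mem_monomialsIn_span (K := K).2 ⟨v, hv, le_rfl⟩
  rw [hspan] at hvI
  obtain ⟨w, hw, hwv⟩ := mem_monomialsIn_span.1 hvI
  have hwu := eq_of_le_of_degree_eq (hwv.trans hvu) (hud.trans hw.2.symm)
  rw [← le_antisymm hvu (hwu ▸ hwv)]
  exact hV v hv

theorem degree_sub_single_add_single {m : ℕ} {u : Fin m →₀ ℕ} {p q : Fin m}
    (hq : q ∈ u.support) :
    (u - Finsupp.single q 1 + Finsupp.single p 1).degree = u.degree := by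
  have hle : Finsupp.single q 1 ≤ u :=
    Finsupp.single_le_iff.2 (Nat.one_le_iff_ne_zero.2 (Finsupp.mem_support_iff.1 hq))
  conv_rhs => rw [← tsub_add_cancel_of_le hle]
  simp only [map_add, Finsupp.degree_single]

theorem degree_of_mem_monomialsOf {e m d : ℕ} {E : Set (Fin d → ℕ)} {u : Fin m →₀ ℕ}
    (hu : u ∈ monomialsOf e m E) : u.degree = d := by
  obtain ⟨r, -, ρ, -, rfl⟩ := hu
  exact degree_seqMonomial ρ

theorem IsStableFamily.monomialsOf_nonempty {e n d m : ℕ} (hm : m = n + e * d)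
    {E : Set (Fin (d + 1) → ℕ)} (hE : IsStableFamily n d E) : (monomialsOf e m E).Nonempty := by
  obtain ⟨r, hr⟩ := hE.nonempty
  obtain ⟨ρ, hρ⟩ := exists_isSpread (e := e) hm (hE.lt r hr)
  exact ⟨_, r, hr, ρ, hρ, rfl⟩

/-! ### Reduction of both ideal conditions to stable families. -/

theorem exists_isStronglyStable_iff {K : Type*} [Field K] (n d : ℕ) (ℓ : Fin n → ℕ) :
    (∃ I : Ideal (MvPolynomial (Fin n) K),
      I ≠ ⊥ ∧ IsStronglyStable I ∧ IsGeneratedInDegree I (d + 1) ∧ ellSeq I = ℓ) ↔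
    ∃ E : Set (Fin (d + 1) → ℕ), IsStableFamily n d E ∧
      ∀ k : Fin n, {r | r ∈ E ∧ r (Fin.last d) = k}.ncard = ℓ k := by
  have hm : n = n + 0 * d := by simp
  have hcount : ∀ (E : Set (Fin (d + 1) → ℕ)) (k : Fin n), IsStableFamily n d E →
      ellSeq (Ideal.span ((fun u => MvPolynomial.monomial u (1 : K)) '' monomialsOf 0 n E)) k =
        {r | r ∈ E ∧ r (Fin.last d) = k}.ncard := by
    intro E k hE
    rw [ellSeq, minGens_span fun u hu => degree_of_mem_monomialsOf hu,
      ← ncard_monomialsOf hm hE k, zero_mul, add_zero]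
  constructor
  · rintro ⟨I, hne, ⟨hI, hst⟩, hd, rfl⟩
    have hspan := hI.eq_span_of_isGeneratedInDegree hd
    obtain ⟨E, hE, hEV⟩ := IsStronglyStableSet.exists_isStableFamily (d := d)
      (V := {u | u ∈ monomialsIn I ∧ u.degree = d + 1})
      (fun u p q hpq hu => ⟨hst u p q hpq hu.1, by
        have := hu.2
        rw [map_add, Finsupp.degree_single] at this ⊢
        exact this⟩)
      (span_monomials_ne_bot.1 (hspan ▸ hne)) fun u hu => hu.2
    refine ⟨E, hE, fun k => ?_⟩
    rw [hspan, ← hEV, hcount E k hE]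
  · rintro ⟨E, hE, hℓ⟩
    exact ⟨_, span_monomials_ne_bot.2 (hE.monomialsOf_nonempty hm), hE.isStronglyStableSet.span,
      isGeneratedInDegree_span fun u hu => degree_of_mem_monomialsOf hu,
      funext fun k => (hcount E k hE).trans (hℓ k)⟩

theorem exists_isSquarefreeStronglyStable_iff {K : Type*} [Field K] (n d : ℕ) (ℓ : Fin n → ℕ) :
    (∃ I : Ideal (MvPolynomial (Fin (n + (d + 1) - 1)) K),
      I ≠ ⊥ ∧ IsSquarefreeStronglyStable I ∧ IsGeneratedInDegree I (d + 1) ∧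
        ellStarSeq n (d + 1) I = ℓ) ↔
    ∃ E : Set (Fin (d + 1) → ℕ), IsStableFamily n d E ∧
      ∀ k : Fin n, {r | r ∈ E ∧ r (Fin.last d) = k}.ncard = ℓ k := by
  have hm : n + (d + 1) - 1 = n + 1 * d := by omega
  have hcount : ∀ (E : Set (Fin (d + 1) → ℕ)) (k : Fin n), IsStableFamily n d E →
      ellStarSeq n (d + 1) (Ideal.span ((fun u => MvPolynomial.monomial u (1 : K)) ''
        monomialsOf 1 (n + (d + 1) - 1) E)) k = {r | r ∈ E ∧ r (Fin.last d) = k}.ncard := by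
    intro E k hE
    rw [ellStarSeq, minGens_span fun u hu => degree_of_mem_monomialsOf hu,
      ← ncard_monomialsOf hm hE k, show (k : ℕ) + 1 + (d + 1) - 1 = k + 1 * d + 1 by omega]
  constructor
  · rintro ⟨I, hne, ⟨hI, hst⟩, hd, rfl⟩
    have hspan := hI.isMonomialIdeal.eq_span_of_isGeneratedInDegree hd
    have hsq : ∀ u ∈ {u | u ∈ monomialsIn I ∧ u.degree = d + 1}, IsSquarefreeMonomial u :=
      fun u hu => hI.isSquarefreeMonomial hd hu.1 hu.2
    obtain ⟨E, hE, hEV⟩ := IsSquarefreeStronglyStableSet.exists_isStableFamily hm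
      (V := {u | u ∈ monomialsIn I ∧ u.degree = d + 1})
      (fun u hu p q hpq hp hq => ⟨(hst u ⟨hu.1, hsq u hu⟩ p q hpq hp hq).1,
        (degree_sub_single_add_single hq).trans hu.2⟩)
      (span_monomials_ne_bot.1 (hspan ▸ hne)) (fun u hu => hu.2) hsq
    refine ⟨E, hE, fun k => ?_⟩
    rw [hspan, ← hEV, hcount E k hE]
  · rintro ⟨E, hE, hℓ⟩
    refine ⟨_, span_monomials_ne_bot.2 (hE.monomialsOf_nonempty hm),
      hE.isSquarefreeStronglyStableSet.span ?_,
      isGeneratedInDegree_span fun u hu => degree_of_mem_monomialsOf hu,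
      funext fun k => (hcount E k hE).trans (hℓ k)⟩
    rintro _ ⟨r, hr, ρ, hρ, rfl⟩
    exact isSquarefreeMonomial_seqMonomial.2 (hρ.injective (hE.monotone r hr))

end MonomialIdeals

open MonomialIdeals in
theorem mainTheorem12 {K : Type*} [Field K] (n d : ℕ) (hd : 0 < d) (ℓ : Fin n → ℕ) :
    List.TFAE [
      ∃ I : Ideal (MvPolynomial (Fin n) K),
        I ≠ ⊥ ∧ IsStronglyStable I ∧ IsGeneratedInDegree I d ∧ ellSeq I = ℓ,
      ∃ I : Ideal (MvPolynomial (Fin (n + d - 1)) K),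
        I ≠ ⊥ ∧ IsSquarefreeStronglyStable I ∧ IsGeneratedInDegree I d ∧ ellStarSeq n d I = ℓ,
      IsMVector ℓ ∧ ∀ h2 : 1 < n, ℓ ⟨1, h2⟩ ≤ d] := by
  obtain ⟨d, rfl⟩ : ∃ e, d = e + 1 := ⟨d - 1, by omega⟩
  rw [exists_isStronglyStable_iff, exists_isSquarefreeStronglyStable_iff]
  have h : (∃ E : Set (Fin (d + 1) → ℕ), IsStableFamily n d E ∧
      ∀ k : Fin n, {r | r ∈ E ∧ r (Fin.last d) = k}.ncard = ℓ k) ↔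
      IsMVector ℓ ∧ ∀ h2 : 1 < n, ℓ ⟨1, h2⟩ ≤ d + 1 :=
    ⟨fun ⟨_, hE, hℓ⟩ => hE.isMVector hℓ, fun ⟨hM, h2⟩ => hM.exists_isStableFamily h2⟩
  rw [h]
  tfae_finish
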